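/- **Proposition 4.1 (Loop-interlacements point process extension).** Fix $d\in\mathbb N$ and $\beta\in(0,\infty)$, and put $W_R=[-R,R]^d$ for $R\in\mathbb N=\{1,2,\dots\}$. *Paths.* For $k\in\mathbb N$ let $\mathcal C_k$ be the set of continuous functions $f\colon[0,k\beta]\to\mathbb R^d$ with the topology of uniform convergence, and write $\ell(f)=k$ for $f\in\mathcal C_k$. Let $\mathcal C=\bigcup_{k\in\mathbb N}\mathcal C_k$ be the disjoint union, with its Borel $\sigma$-field. A *loop* of length $k$ is an $f\in\mathcal C_k$ with $f(0)=f(k\beta)$, where loops that are cyclic time-shifts of each other by an integer multiple of $\beta$ are identified; $\mathcal C^{\circlearrowleft}$ is the space of loops, with the quotient $\sigma$-field. An *interlacement* is a continuous function $g\colon\mathbb R\to\mathbb R^d$ such that every compact set contains $g(k\beta)$ for only finitely many $k\in\mathbb Z$, where time-shifts by integer multiples of $\beta$ are identified; $\mathcal C_\infty$ is the set of interlacements. The values at integer multiples of $\beta$ are called the *particles*. *Shreds.* For $W\subset\mathbb R^d$, a *$W$-shred* is an $s\in\mathcal C_n$ with $n\ge2$, $s(0)\notin W$, $s(\beta),\dots,s((n-1)\beta)\in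 W$ and $s(n\beta)\notin W$. The $W$-shreds of an interlacement, of a loop (extended periodically; initial times are counted modulo the period), or of a $W'$-shred with $W\subset W'$, are all the pieces of it on intervals $[a\beta,(a+n)\beta]$ with $a\in\mathbb Z$, shifted in time to $[0,n\beta]$, that are $W$-shreds, counted with multiplicity. A loop with all its particles in $W$ has no $W$-shreds. *Configurations.* A marked loop is a pair $(x,f)$ with $x\in\mathbb R^d$, $f\in\mathcal C^{\circlearrowleft}$ and $f(0)=x$ for some representative of $f$. Let $\mathcal L_W$ be the set of finite simple point measures on the marked loops $(x,f)$ such that all particles of $f$ lie in $W$, and $\mathcal S_W$ the set of finite simple point measures on the $W$-shreds; $\mathcal L_W\times\mathcal S_W$ carries the $\sigma$-field generated by the evaluations of the two point measures at measurable sets. Let $\mathcal L$ be the set of simple point measures on the marked loops with only finitely many loops starting (i.e., with $x$) in any bounded set, and $\mathcal S$ the set of simple point measures on $\mathcal C_\infty$ with only finitely many particles in any compact set. *Projections.* For $(\omega,\varpi)\in\mathcal L\times\mathcal S$ let $\Pi_W(\omega,\varpi)$ be the pair consisting of the point measure of all the loops of $\omega$ that have all their particles in $W$, and the point measure (with multiplicities)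 of all the $W$-shreds of the other loops of $\omega$ and of the interlacements of $\varpi$. For $W\subset W'$, the projection $\Pi_{W'\to W}$ is defined on $\mathcal L_{W'}\times\mathcal S_{W'}$ in the same way, with the $W'$-shreds in place of the interlacements. Let $\mathcal L\times\mathcal S$ carry the $\sigma$-field generated by the maps $\Pi_{W_R}$, $R\in\mathbb N$, where the $\sigma$-field on pairs of measures is generated by the evaluations at measurable sets. **Claim.** Let $(\xi^{(W_R)})_{R\in\mathbb N}$ be a family of probability measures $\xi^{(W_R)}$ on $\mathcal L_{W_R}\times\mathcal S_{W_R}$ that is consistent, i.e., such that $\Pi_{W_{R+1}\to W_R}(\xi^{(W_{R+1})})=\xi^{(W_R)}$ for every $R\in\mathbb N$. Then there exists a unique probability measure $P$ on $\mathcal L\times\mathcal S$ such that $\Pi_{W_R}(P)=\xi^{(W_R)}$ for every $R\in\mathbb N$. Here $\Pi(\mu)=\mu\circ\Pi^{-1}$ denotes the image measure, and $\xi^{(W_R)}$ is also regarded as a measure on the set of all pairs of measures, in which $\mathcal L_{W_R}\times\mathcal S_{W_R}$ is contained. -/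

import Mathlib

open Set MeasureTheory

noncomputable section

namespace BoseGas

/-- Simple point measures are represented by their sets of atoms; this is the corresponding
measure `∑_{p ∈ Γ} δ_p`. -/
def pointMeasure {X : Type*} [MeasurableSpace X] (Γ : Set X) : Measure X :=
  Measure.sum fun p : Γ => Measure.dirac (p : X)

variable (d : ℕ) (β : ℝ)

/-- The space `ℝ^d`. -/
abbrev Space : Type := EuclideanSpace ℝ (Fin d)

/-- The box `W_R = [-R, R]^d`. -/
def box (R : ℕ+) : Set (Space d) := {x | ∀ i, |x i| ≤ (R : ℝ)}

/-! ### Paths with finitely many legs -/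

/-- The space `𝒞 = ⋃_{k ≥ 1} 𝒞_k`, where `𝒞_k` is the set of continuous functions
`[0, kβ] → ℝ^d`. -/
def LegPath : Type := Σ k : ℕ+, C(Icc (0 : ℝ) ((k : ℝ) * β), Space d)

/-- The topology of the disjoint union of the spaces `𝒞_k`, each carrying the topology of uniform
convergence (which is the compact-open topology, since `[0, kβ]` is compact). -/
instance : TopologicalSpace (LegPath d β) :=
  inferInstanceAs (TopologicalSpace (Σ k : ℕ+, C(Icc (0 : ℝ) ((k : ℝ) * β), Space d)))

instance : MeasurableSpace (LegPath d β) := borel _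

instance : BorelSpace (LegPath d β) := ⟨rfl⟩

variable {d β}

/-- The length `ℓ(f) = k` of `f ∈ 𝒞_k`. -/
def LegPath.length (f : LegPath d β) : ℕ := (f.1 : ℕ)

/-- The end time `ℓ(f) β`. -/
def LegPath.duration (f : LegPath d β) : ℝ := (f.length : ℝ) * β

theorem LegPath.length_pos (f : LegPath d β) : 0 < f.length := f.1.pos

theorem LegPath.duration_pos [hβ : Fact (0 < β)] (f : LegPath d β) : 0 < f.duration :=
  mul_pos (Nat.cast_pos.mpr f.length_pos) hβ.out

/-- The value of `f` at time `t`; for `t` outside of `[0, ℓ(f)β]`, this is the value at the endpoint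
that is closest to `t`. -/
def LegPath.eval [hβ : Fact (0 < β)] (f : LegPath d β) (t : ℝ) : Space d :=
  f.2 (projIcc 0 ((f.1 : ℝ) * β)
    (mul_nonneg (Nat.cast_nonneg (f.1 : ℕ)) hβ.out.le) t)

/-! ### Loops -/

variable (d β)

/-- The functions `f ∈ 𝒞` with `f(0) = f(ℓ(f)β)`. -/
def RootedLoop [Fact (0 < β)] : Type := {f : LegPath d β // f.eval 0 = f.eval f.duration}

instance [Fact (0 < β)] : MeasurableSpace (RootedLoop d β) :=
  inferInstanceAs (MeasurableSpace {f : LegPath d β // f.eval 0 = f.eval f.duration})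

variable {d β}

/-- The `ℓ(f)β`-periodic extension of a loop `f` to `ℝ`. -/
def RootedLoop.periodic [Fact (0 < β)] (f : RootedLoop d β) (t : ℝ) : Space d :=
  f.1.eval (toIcoMod f.1.duration_pos 0 t)

variable (d β)

/-- Two loops are identified if they have the same length and are (cyclic) time-shifts of each
other by an integer multiple of `β`. -/
instance loopSetoid [Fact (0 < β)] : Setoid (RootedLoop d β) where
  r f g := f.1.length = g.1.length ∧ ∃ j : ℤ, ∀ t, g.periodic t = f.periodic (t + j * β)
  iseqv :=
    { refl := fun f => ⟨rfl, 0, fun t => by simp⟩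
      symm := by
        rintro f g ⟨h, j, hj⟩
        refine ⟨h.symm, -j, fun t => ?_⟩
        rw [hj]
        congr 1
        push_cast
        ring
      trans := by
        rintro f g h ⟨h1, i, hi⟩ ⟨h2, j, hj⟩
        refine ⟨h1.trans h2, j + i, fun t => ?_⟩
        rw [hj, hi]
        congr 1
        push_cast
        ring }

/-- The loop space `𝒞^↺`. It carries the quotient `σ`-field. (The quotient of each `𝒞_k^↺` is by an
action of the finite group `ℤ/k` by homeomorphisms, hence this is also the Borel `σ`-field of the
quotient topology.) -/
def Loop [Fact (0 < β)] : Type := Quotient (loopSetoid d β)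

instance [Fact (0 < β)] : MeasurableSpace (Loop d β) :=
  inferInstanceAs (MeasurableSpace (Quotient (loopSetoid d β)))

/-- The space of the points `(x, f) ∈ ℝ^d × 𝒞^↺` with `f(0) = x` (for some representative of the
loop `f`). -/
def MarkedLoop [Fact (0 < β)] : Type :=
  {p : Space d × Loop d β // ∃ f : RootedLoop d β, Quotient.mk _ f = p.2 ∧ f.1.eval 0 = p.1}

instance [Fact (0 < β)] : MeasurableSpace (MarkedLoop d β) :=
  inferInstanceAs (MeasurableSpace {p : Space d × Loop d β //
    ∃ f : RootedLoop d β, Quotient.mk _ f = p.2 ∧ f.1.eval 0 = p.1})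

variable {d β}

/-- All the particles `f(kβ)`, `k ∈ ℤ`, of the loop `f` lie in `W`. -/
def Loop.AllIn [Fact (0 < β)] (W : Set (Space d)) : Loop d β → Prop :=
  Quotient.lift (fun f : RootedLoop d β => ∀ k : ℤ, f.periodic (k * β) ∈ W) (by
    have key : ∀ f g : RootedLoop d β, f ≈ g →
        (∀ k : ℤ, f.periodic (k * β) ∈ W) → ∀ k : ℤ, g.periodic (k * β) ∈ W := by
      rintro f g ⟨-, j, hj⟩ hf k
      rw [hj, ← add_mul]
      exact_mod_cast hf (k + j)
    intro f g h
    exact propext ⟨key f g h, key g f (Setoid.symm h)⟩)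

/-! ### Interlacements -/

variable (d β)

/-- The continuous functions `g : ℝ → ℝ^d` such that every compact set contains `g(kβ)` for only
finitely many `k ∈ ℤ`. -/
def Trajectory : Type :=
  {g : C(ℝ, Space d) // ∀ K : Set (Space d), IsCompact K → {k : ℤ | g (k * β) ∈ K}.Finite}

/-- Trajectories are identified if they are time-shifts of each other by an integer multiple
of `β`. -/
instance trajectorySetoid : Setoid (Trajectory d β) where
  r f g := ∃ j : ℤ, ∀ t, g.1 t = f.1 (t + j * β)
  iseqv :=
    { refl := fun f => ⟨0, fun t => by simp⟩
      symm := by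
        rintro f g ⟨j, hj⟩
        refine ⟨-j, fun t => ?_⟩
        rw [hj]
        congr 1
        push_cast
        ring
      trans := by
        rintro f g h ⟨i, hi⟩ ⟨j, hj⟩
        refine ⟨j + i, fun t => ?_⟩
        rw [hj, hi]
        congr 1
        push_cast
        ring }

/-- The interlacement space `𝒞_∞`. -/
def Interlacement : Type := Quotient (trajectorySetoid d β)

variable {d β}

/-- The interlacement has at least one particle `g(kβ)`, `k ∈ ℤ`, in `K`. -/
def Interlacement.Visits (K : Set (Space d)) : Interlacement d β → Prop :=
  Quotient.lift (fun g : Trajectory d β => ∃ k : ℤ, g.1 (k * β) ∈ K) (by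
    have key : ∀ f g : Trajectory d β, f ≈ g →
        (∃ k : ℤ, g.1 (k * β) ∈ K) → ∃ k : ℤ, f.1 (k * β) ∈ K := by
      rintro f g ⟨j, hj⟩ ⟨k, hk⟩
      refine ⟨k + j, ?_⟩
      rw [hj, ← add_mul] at hk
      exact_mod_cast hk
    intro f g h
    exact propext ⟨key g f (Setoid.symm h), key f g h⟩)

/-! ### Shreds -/

section Shreds

variable [Fact (0 < β)] (W : Set (Space d))

/-- `s` is a `W`-shred: it has at least one particle in `W`, and the times `jβ`,
`0 ≤ j ≤ ℓ(s)`, at which `s(jβ) ∉ W` are precisely the initial time `0` and the final time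
`ℓ(s)β`. -/
def IsShred (s : LegPath d β) : Prop :=
  2 ≤ s.length ∧ s.eval 0 ∉ W ∧ s.eval s.duration ∉ W ∧
    ∀ j : ℕ, 1 ≤ j → j < s.length → s.eval (j * β) ∈ W

/-- `s` is the piece of `g : ℝ → ℝ^d` on the time interval `[aβ, (a + ℓ(s))β]`, shifted in time. -/
def IsPiece (g : ℝ → Space d) (a : ℤ) (s : LegPath d β) : Prop :=
  ∀ t ∈ Icc 0 s.duration, s.eval t = g (a * β + t)

/-- `δ_s` if some `W`-shred `s` of `g` begins at time `aβ`, and zero otherwise. (There is at most one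
such `s`, since its length is determined by the first return to the complement of `W`.) -/
def shredAt (g : ℝ → Space d) (a : ℤ) : Measure (LegPath d β) :=
  pointMeasure {s | IsShred W s ∧ IsPiece g a s}

/-- The point measure of all the `W`-shreds of `s`, where `s(0)` and `s(ℓ(s)β)` are assumed to lie
outside of `W`. (Since `s.eval` is constant on `(-∞, 0]` and on `[ℓ(s)β, ∞)`, the windows of these
shreds are contained in `[0, ℓ(s)β]`.) -/
def pathShreds (s : LegPath d β) : Measure (LegPath d β) :=
  Measure.sum fun a : ℤ => shredAt W s.eval a

theorem shredAt_shift (f g : ℝ → Space d) (j : ℤ) (h : ∀ t, g t = f (t + j * β)) (a : ℤ) :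
    shredAt (β := β) W g a = shredAt W f (a + j) := by
  have : ∀ s : LegPath d β, IsPiece g a s ↔ IsPiece f (a + j) s := by
    intro s
    refine forall₂_congr fun t _ => ?_
    rw [h]
    push_cast
    rw [show (a : ℝ) * β + t + j * β = ((a : ℝ) + j) * β + t by ring]
  simp only [shredAt, this]

theorem sum_range_shift {M : Type*} [AddCommMonoid M] (n : ℕ) (F : ℤ → M)
    (hF : ∀ a, F (a + n) = F a) (j : ℤ) :
    ∑ a ∈ Finset.range n, F (a + j) = ∑ a ∈ Finset.range n, F a := by
  have step : ∀ G : ℤ → M, (∀ a, G (a + n) = G a) →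
      ∑ a ∈ Finset.range n, G (a + 1) = ∑ a ∈ Finset.range n, G a := by
    intro G hG
    cases n with
    | zero => simp
    | succ m =>
      rw [Finset.sum_range_succ, Finset.sum_range_succ' (fun a : ℕ => G a)]
      have := hG 0
      simp only [zero_add, Nat.cast_add, Nat.cast_one] at this
      simp [this]
  induction j with
  | zero => simp
  | succ i ih =>
    rw [← ih, ← step (fun a => F (a + i)) (fun a => by rw [← hF (a + i)]; congr 1; ring)]
    refine Finset.sum_congr rfl fun a _ => ?_
    congr 1
    ring
  | pred i ih =>
    rw [← ih, ← step (fun a => F (a + (-i - 1)))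
      (fun a => by rw [← hF (a + (-i - 1))]; congr 1; ring)]
    refine Finset.sum_congr rfl fun a _ => ?_
    congr 1
    ring

theorem RootedLoop.periodic_add (f : RootedLoop d β) (t : ℝ) :
    f.periodic (t + f.1.length * β) = f.periodic t := by
  unfold RootedLoop.periodic
  congr 1
  exact toIcoMod_add_right f.1.duration_pos 0 t

/-- The point measure of all the `W`-shreds of a loop; their initial times are counted modulo the
period of the loop. It is zero if all the particles of the loop lie in `W`, or if none does. -/
def Loop.shreds : Loop d β → Measure (LegPath d β) :=
  Quotient.lift
    (fun f : RootedLoop d β => ∑ a ∈ Finset.range f.1.length, shredAt W f.periodic (a : ℤ)) (by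
    rintro f g ⟨hl, j, hj⟩
    simp only [← hl, shredAt_shift W _ _ j hj]
    refine (sum_range_shift f.1.length (fun a => shredAt W f.periodic a) (fun a => ?_) j).symm
    refine (shredAt_shift W _ _ (f.1.length : ℤ) (fun t => ?_) a).symm
    exact_mod_cast (f.periodic_add t).symm)

/-- The point measure of all the `W`-shreds of an interlacement. -/
def Interlacement.shreds : Interlacement d β → Measure (LegPath d β) :=
  Quotient.lift
    (fun g : Trajectory d β => Measure.sum fun a : ℤ => shredAt W g.1 a) (by
    rintro f g ⟨j, hj⟩
    simp only [shredAt_shift W _ _ j hj]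
    exact (Measure.sum_comp_equiv (Equiv.addRight j) fun a : ℤ => shredAt W f.1 a).symm)

end Shreds

/-! ### Configurations in a box -/

section Configurations

variable [Fact (0 < β)]

variable (β) in
/-- The set `ℒ_W × 𝒮_W` of pairs of a finite simple point measure on the marked loops that have all
their particles in `W` and a finite simple point measure on the `W`-shreds. -/
structure BoxConfig (W : Set (Space d)) where
  loops : Set (MarkedLoop d β)
  shreds : Set (LegPath d β)
  finite_loops : loops.Finite
  finite_shreds : shreds.Finite
  allIn : ∀ p ∈ loops, p.1.2.AllIn W
  isShred : ∀ s ∈ shreds, IsShred W s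

/-- The pair of point measures that a configuration stands for. -/
def BoxConfig.toMeasures {W : Set (Space d)} (c : BoxConfig β W) :
    Measure (MarkedLoop d β) × Measure (LegPath d β) :=
  (pointMeasure c.loops, pointMeasure c.shreds)

/-- The `σ`-field on `ℒ_W × 𝒮_W` that is generated by the evaluations `μ ↦ μ(A)` of the two point
measures at measurable sets `A`. -/
instance (W : Set (Space d)) : MeasurableSpace (BoxConfig β W) :=
  MeasurableSpace.comap BoxConfig.toMeasures inferInstance

/-- The projection `Π_{W' → W}` for `W ⊆ W'`: it keeps the loops that have all their particles in
`W`, and it cuts the other loops and the `W'`-shreds into `W`-shreds. The result is a pair of point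
measures, which need not be simple since the same shred may arise several times. -/
def BoxConfig.proj {W' : Set (Space d)} (W : Set (Space d)) (c : BoxConfig β W') :
    Measure (MarkedLoop d β) × Measure (LegPath d β) :=
  (pointMeasure {p ∈ c.loops | p.1.2.AllIn W},
    (Measure.sum fun p : c.loops => p.1.1.2.shreds W) +
      Measure.sum fun s : c.shreds => pathShreds W (s : LegPath d β))

/-! ### Configurations in the whole space -/

variable (d β) in
/-- The set `ℒ × 𝒮` of loop-interlacement configurations: simple point measures on the marked loops
with only finitely many loops starting in any bounded set, together with simple point measures on
the interlacements with only finitely many particles in any compact set. (As each interlacement has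
only finitely many particles in a compact set, the latter means that only finitely many
interlacements have a particle there.) -/
structure Config where
  loops : Set (MarkedLoop d β)
  interlacements : Set (Interlacement d β)
  finite_loops : ∀ A : Set (Space d), Bornology.IsBounded A → {p ∈ loops | p.1.1 ∈ A}.Finite
  finite_interlacements :
    ∀ K : Set (Space d), IsCompact K → {g ∈ interlacements | g.Visits K}.Finite

/-- The operator `Π_W`: it keeps the loops that have all their particles in `W`, and it cuts the
other loops and the interlacements into `W`-shreds. -/
def Config.proj (W : Set (Space d)) (c : Config d β) :
    Measure (MarkedLoop d β) × Measure (LegPath d β) :=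
  (pointMeasure {p ∈ c.loops | p.1.2.AllIn W},
    (Measure.sum fun p : c.loops => p.1.1.2.shreds W) +
      Measure.sum fun g : c.interlacements => (g : Interlacement d β).shreds W)

/-- The `σ`-field on `ℒ × 𝒮` that is generated by the operators `Π_{W_R}` with `R ∈ ℕ`. -/
instance : MeasurableSpace (Config d β) :=
  ⨆ R : ℕ+, MeasurableSpace.comap (Config.proj (box d R)) inferInstance

end Configurations

end BoseGas

end

/-! The probabilistic part and the geometric part separate.

Probability (`existsUnique_measure_of_consistent`): on standard Borel spaces of box configurations,
the Ionescu-Tulcea construction turns the consistent laws into the law of one random sequence. Given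
the configuration in one box, the next is drawn from its conditional law. Almost every such sequence
is consistent, so if every consistent sequence consists of the projections of one global
configuration, the law can be carried to the global space. Measurability of this transport is cheap,
because the global σ-field is generated by the projections. For uniqueness, a smaller projection is
almost surely a fixed measurable function of the next larger one. The given laws therefore determine
all finite-dimensional laws of the sequence of projections.

Standard Borel structure (`BoxConfig.measurableEmbedding_toMeasures`): real codes select a canonical
representative of each marked loop and an increasing enumeration of each finite set. The theorem of
Lusin and Souslin then shows that the resulting measurable bijections have measurable inverses.

Geometry (`exists_config_proj_eq`): each shred of a small window lies in exactly one shred of a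
larger window, so cutting in stages agrees with cutting at once (`shredAt_eq_tsum`, `cut_eq_proj`).
Since the given point measures are simple, every given shred arises exactly once from the larger
window (`Consistent.mult_eq`). Followed outwards, it either becomes part of a loop or lies in a
nested sequence of shreds growing at both ends, whose union is an interlacement (`exists_fits`).
Local finiteness holds because each box has finitely many shreds and each of them is used only once.
-/

noncomputable section

namespace BoseGas

/-! ### Standard Borel spaces -/

/-- A countable disjoint union of Polish spaces is Polish. -/
instance sigma_polishSpace {ι : Type*} [Countable ι] {E : ι → Type*}
    [∀ i, TopologicalSpace (E i)] [∀ i, PolishSpace (E i)] : PolishSpace (Σ i, E i) := by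
  let := fun i => TopologicalSpace.upgradeIsCompletelyMetrizable (E i)
  let : MetricSpace (Σ i, E i) := Metric.Sigma.metricSpace
  have : CompleteSpace (Σ i, E i) := Metric.Sigma.completeSpace
  infer_instance

open MeasurableSpace in
/-- A countable disjoint union of standard Borel spaces is standard Borel. -/
instance sigma_standardBorelSpace {ι : Type*} [Countable ι] {E : ι → Type*}
    [∀ i, MeasurableSpace (E i)] [∀ i, StandardBorelSpace (E i)] :
    StandardBorelSpace (Σ i, E i) := by
  let := fun i => upgradeStandardBorel (E i)
  have : BorelSpace (Σ i, E i) := by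
    refine ⟨le_antisymm ?_ ?_⟩
    · intro s hs
      have hs' : ∀ i, MeasurableSet (Sigma.mk i ⁻¹' s) := fun i =>
        measurableSet_iInf.mp hs i
      have hU : s = ⋃ i, Sigma.mk i '' (Sigma.mk i ⁻¹' s) := by
        ext ⟨i, x⟩
        refine ⟨fun h => mem_iUnion.mpr ⟨i, x, h, rfl⟩, fun h => ?_⟩
        obtain ⟨j, y, hy, he⟩ := mem_iUnion.mp h
        exact he ▸ hy
      let : MeasurableSpace (Σ i, E i) := borel _
      have : BorelSpace (Σ i, E i) := ⟨rfl⟩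
      rw [hU]
      refine MeasurableSet.iUnion fun i => ?_
      exact (Topology.IsOpenEmbedding.sigmaMk.measurableEmbedding).measurableSet_image.mpr (hs' i)
    · refine generateFrom_le fun u hu => measurableSet_iInf.mpr fun i => ?_
      have h : IsOpen (Sigma.mk i ⁻¹' u) := hu.preimage continuous_sigmaMk
      exact h.measurableSet
  infer_instance

/-- A countably separated measurable bijective image of a standard Borel space is standard
Borel. -/
theorem standardBorelSpace_of_bijective {X Y : Type*} [MeasurableSpace X] [StandardBorelSpace X]
    [MeasurableSpace Y] [MeasurableSpace.CountablySeparated Y] {f : X → Y} (hf : Measurable f)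
    (hb : Function.Bijective f) : StandardBorelSpace Y := by
  -- Lusin–Souslin: an injective measurable map from a standard Borel space to a countably separated
  -- one has measurable images of measurable sets.
  have he := hf.measurableEmbedding hb.1
  let := upgradeStandardBorel X
  let g := (Equiv.ofBijective f hb).symm
  have hg : MeasurableEmbedding g := by
    refine ⟨g.injective, fun s hs => ?_, fun s hs => ?_⟩
    · rw [← Equiv.image_eq_preimage_symm]
      exact he.measurableSet_image.mpr hs
    · rw [Equiv.image_symm_eq_preimage]
      exact hf hs
  let := TopologicalSpace.induced g inferInstance
  have hc : Topology.IsClosedEmbedding g :=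
    ⟨⟨⟨rfl⟩, g.injective⟩, by rw [g.range_eq_univ]; exact isClosed_univ⟩
  have : PolishSpace Y := hc.polishSpace
  have : BorelSpace Y := ⟨by
    rw [← hg.comap_eq]
    exact (congrArg _ (eq_borel_upgradeStandardBorel X)).trans borel_comap.symm⟩
  infer_instance

/-- Injective measurable maps pull back countable separation. -/
theorem countablySeparated_of_injective {X Y : Type*} [MeasurableSpace X] [MeasurableSpace Y]
    [MeasurableSpace.CountablySeparated Y] {f : X → Y} (hf : Measurable f)
    (hi : Function.Injective f) : MeasurableSpace.CountablySeparated X := by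
  obtain ⟨S, hS, hm, hsep⟩ := exists_countable_separating Y MeasurableSet univ
  refine ⟨⟨preimage f '' S, hS.image _, ?_, ?_⟩⟩
  · rintro _ ⟨s, hs, rfl⟩
    exact hf (hm s hs)
  · intro x _ y _ h
    refine hi (hsep _ trivial _ trivial fun s hs => ?_)
    exact h _ ⟨s, hs, rfl⟩

theorem measurable_sigma_iff {ι Y : Type*} {E : ι → Type*} [∀ i, MeasurableSpace (E i)]
    [MeasurableSpace Y] {f : (Σ i, E i) → Y} :
    Measurable f ↔ ∀ i, Measurable fun x => f ⟨i, x⟩ :=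
  ⟨fun h i _ hs => MeasurableSpace.measurableSet_iInf.mp (h hs) i,
    fun h _ hs => MeasurableSpace.measurableSet_iInf.mpr fun i => h i hs⟩

instance prod_countablySeparated {X Y : Type*} [MeasurableSpace X] [MeasurableSpace Y]
    [MeasurableSpace.CountablySeparated X] [MeasurableSpace.CountablySeparated Y] :
    MeasurableSpace.CountablySeparated (X × Y) := by
  obtain ⟨S, hS, hSm, hSs⟩ := exists_countable_separating X MeasurableSet univ
  obtain ⟨T, hT, hTm, hTs⟩ := exists_countable_separating Y MeasurableSet univ
  refine ⟨⟨preimage Prod.fst '' S ∪ preimage Prod.snd '' T,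
    (hS.image _).union (hT.image _), ?_, ?_⟩⟩
  · rintro _ (⟨s, hs, rfl⟩ | ⟨s, hs, rfl⟩)
    · exact measurable_fst (hSm s hs)
    · exact measurable_snd (hTm s hs)
  · intro x _ y _ h
    exact Prod.ext (hSs _ trivial _ trivial fun s hs => h _ (.inl ⟨s, hs, rfl⟩))
      (hTs _ trivial _ trivial fun s hs => h _ (.inr ⟨s, hs, rfl⟩))

/-- The finite measures on a standard Borel space are countably separated. -/
instance finiteMeasures_countablySeparated {X : Type*} [MeasurableSpace X]
    [StandardBorelSpace X] : MeasurableSpace.CountablySeparated {μ : Measure X | μ univ < ⊤} := by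
  have hemb := measurableEmbedding_embeddingReal X
  -- Rational half-lines form a generating π-system of the line. The total mass, stored at `none`,
  -- is needed because the measures are not normalized.
  refine countablySeparated_of_injective
    (f := fun (μ : {μ : Measure X | μ univ < ⊤}) (q : Option ℚ) =>
      q.elim (μ.1 univ) fun q => μ.1 (embeddingReal X ⁻¹' Iic (q : ℝ))) ?_ ?_
  · refine measurable_pi_iff.mpr fun q => ?_
    cases q with
    | none => exact (Measure.measurable_coe MeasurableSet.univ).comp measurable_subtype_coe
    | some q =>
      exact (Measure.measurable_coe (hemb.measurable measurableSet_Iic)).comp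
        measurable_subtype_coe
  · rintro ⟨μ, hμ⟩ ⟨ν, hν⟩ h
    have : IsFiniteMeasure μ := ⟨hμ⟩
    have key : μ.map (embeddingReal X) = ν.map (embeddingReal X) := by
      refine ext_of_generate_finite _ (BorelSpace.measurable_eq.trans
        Real.borel_eq_generateFrom_Iic_rat) Real.isPiSystem_Iic_rat ?_ ?_
      · intro s hs
        obtain ⟨q, rfl⟩ := mem_iUnion.mp hs
        rw [hemb.map_apply, hemb.map_apply]
        exact congrFun h (some q)
      · rw [hemb.map_apply, hemb.map_apply]
        exact congrFun h none
    refine Subtype.ext ?_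
    change μ = ν
    rw [← hemb.comap_map μ, key, hemb.comap_map]

end BoseGas

/-! ### Inverse limits of probability spaces -/

section InverseLimit

open ProbabilityTheory

/-- The kernel sees its source only through `f`. This lets the transition kernels below, which
formally depend on the whole past, be reduced to the present coordinate. -/
theorem MeasureTheory.Measure.map_compProd_comap {α β γ : Type*} [MeasurableSpace α]
    [MeasurableSpace β] [MeasurableSpace γ] (μ : Measure α) [SFinite μ] (κ : Kernel β γ)
    [IsSFiniteKernel κ] {f : α → β} (hf : Measurable f) :
    (μ ⊗ₘ κ.comap f hf).map (Prod.map f id) = μ.map f ⊗ₘ κ := by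
  ext s hs
  rw [Measure.map_apply (hf.prodMap measurable_id) hs, Measure.compProd_apply hs,
    Measure.compProd_apply ((hf.prodMap measurable_id) hs),
    lintegral_map (Kernel.measurable_kernel_prodMk_left hs) hf]
  rfl

/-- Existence of the inverse limit of a sequence of standard Borel probability spaces. -/
theorem exists_measure_inverseLimit {B : ℕ → Type*} [∀ n, MeasurableSpace (B n)]
    [∀ n, StandardBorelSpace (B n)] [∀ n, Nonempty (B n)] (ξ : ∀ n, Measure (B n))
    [∀ n, IsProbabilityMeasure (ξ n)] (q : ∀ n, B (n + 1) → B n) (hq : ∀ n, Measurable (q n))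
    (h : ∀ n, (ξ (n + 1)).map (q n) = ξ n) :
    ∃ Q : Measure (∀ n, B n), IsProbabilityMeasure Q ∧ (∀ n, Q.map (fun x => x n) = ξ n) ∧
      ∀ n, ∀ᵐ x ∂Q, x n = q n (x (n + 1)) := by
  -- A Markov chain running outwards: the next point has the conditional law, under `ξ (n + 1)`, of
  -- a point given its image under `q n`.
  let κ : (n : ℕ) → Kernel (Π i : Finset.Iic n, B i) (B (n + 1)) := fun n =>
    (condDistrib id (q n) (ξ (n + 1))).comap (fun x => x ⟨n, Finset.mem_Iic.mpr le_rfl⟩)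
      (measurable_pi_apply _)
  have : ∀ n, IsMarkovKernel (κ n) := fun n => Kernel.IsMarkovKernel.comap _ _
  let Q := Kernel.trajMeasure (X := B) (ξ 0) κ
  -- Two consecutive coordinates live on the graph of `q n`. This yields both the next marginal and
  -- the almost sure consistency.
  have pair : ∀ n, Q.map (fun x => x n) = ξ n →
      Q.map (fun x => (x n, x (n + 1))) = (ξ (n + 1)).map (fun x => (q n x, x)) := by
    intro n hn
    have h1 := Kernel.map_frestrictLe_trajMeasure_compProd_eq_map_trajMeasure
      (X := B) (μ₀ := ξ 0) (κ := κ) (a := n)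
    have h2 := congrArg (Measure.map (Prod.map
      (fun x : Π i : Finset.Iic n, B i => x ⟨n, Finset.mem_Iic.mpr le_rfl⟩) id)) h1
    rw [Measure.map_compProd_comap, Measure.map_map (by fun_prop) (by fun_prop),
      Measure.map_map (by fun_prop) (by fun_prop)] at h2
    have h3 : (Measure.map ((fun x : Π i : Finset.Iic n, B i =>
      x ⟨n, Finset.mem_Iic.mpr le_rfl⟩) ∘ Preorder.frestrictLe n) Q) = (ξ (n + 1)).map (q n) :=
      hn.trans (h n).symm
    rw [h3, compProd_map_condDistrib aemeasurable_id] at h2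
    exact h2.symm
  have marg : ∀ n, Q.map (fun x => x n) = ξ n := by
    intro n
    induction n with
    | zero =>
      have hr : (fun x : ∀ n, B n => x 0) =
          (fun y : Π i : Finset.Iic 0, B i => y ⟨0, Finset.mem_Iic.mpr le_rfl⟩) ∘
            Preorder.frestrictLe 0 := rfl
      rw [hr, ← Measure.map_map (by fun_prop) (by fun_prop)]
      simp only [Q, Kernel.trajMeasure]
      rw [Measure.map_comp _ _ (by fun_prop), Kernel.traj_map_frestrictLe,
        Kernel.partialTraj_self, Measure.id_comp]
      exact (Measure.map_map (measurable_pi_apply _) (MeasurableEquiv.measurable _)).trans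
        Measure.map_id
    | succ n ih =>
      have := congrArg (Measure.map Prod.snd) (pair n ih)
      rw [Measure.map_map (by fun_prop) (by fun_prop),
        Measure.map_map (by fun_prop) ((hq n).prodMk measurable_id')] at this
      exact this.trans Measure.map_id
  refine ⟨Q, inferInstance, marg, fun n => ?_⟩
  have : ∀ᵐ z ∂(Q.map (fun x => (x n, x (n + 1)))), z.1 = q n z.2 := by
    rw [pair n (marg n), ae_map_iff ((hq n).prodMk measurable_id').aemeasurable
      (measurableSet_eq_fun measurable_fst ((hq n).comp measurable_snd) :
        MeasurableSet {z : B n × B (n + 1) | z.1 = q n z.2})]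
    simp
  exact ae_of_ae_map (by fun_prop) this

end InverseLimit

/-! ### Extension and uniqueness for σ-fields generated by a sequence of projections -/

section ProjectiveExtension

open Filter

theorem MeasurableEmbedding.apply_invFun {α β : Type*} [MeasurableSpace α] [MeasurableSpace β]
    [Nonempty α] {f : α → β} (hf : MeasurableEmbedding f) (x : α) : hf.invFun (f x) = x :=
  hf.leftInverse_invFun x

/-- Let `π n : C → M` generate the `σ`-field of `C`, let `T n : B n → M` be measurable embeddings of
standard Borel spaces, and let `p n : B (n + 1) → M` be bonding maps that are compatible with `π`.
If every consistent sequence comes from a point of `C`, then every consistent family of probability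
measures on the spaces `B n` is induced by a unique probability measure on `C`. -/
theorem existsUnique_measure_of_consistent {M C : Type*} [MeasurableSpace M]
    [mC : MeasurableSpace C] {B : ℕ → Type*} [∀ n, MeasurableSpace (B n)]
    [∀ n, StandardBorelSpace (B n)] [∀ n, Nonempty (B n)] {T : ∀ n, B n → M}
    (hT : ∀ n, MeasurableEmbedding (T n)) (p : ∀ n, B (n + 1) → M) (ξ : ∀ n, Measure (B n))
    [∀ n, IsProbabilityMeasure (ξ n)] (hcons : ∀ n, (ξ (n + 1)).map (p n) = (ξ n).map (T n))
    (π : ℕ → C → M) (hmC : mC = ⨆ n, MeasurableSpace.comap (π n) inferInstance)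
    (glue : ∀ b : ∀ n, B n, (∀ n, p n (b (n + 1)) = T n (b n)) → ∃ c, ∀ n, π n c = T n (b n))
    (compat : ∀ c n b, π (n + 1) c = T (n + 1) b → π n c = p n b) :
    ∃! P : Measure C, IsProbabilityMeasure P ∧ ∀ n, P.map (π n) = (ξ n).map (T n) := by
  have hπ : ∀ n, Measurable (π n) := fun n => by
    rw [measurable_iff_comap_le, hmC]
    exact le_iSup (fun n => MeasurableSpace.comap (π n) inferInstance) n
  have hTprob : ∀ n, IsProbabilityMeasure ((ξ n).map (T n)) := fun n =>
    Measure.isProbabilityMeasure_map (hT n).measurable.aemeasurable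
  -- Measurability of `p n` need not be assumed: the image under a map that is not a.e. measurable
  -- is zero by convention, whereas consistency makes it a probability measure.
  have hp : ∀ n, AEMeasurable (p n) (ξ (n + 1)) := fun n => by
    by_contra h
    have := hcons n
    rw [Measure.map_of_not_aemeasurable h] at this
    exact IsProbabilityMeasure.ne_zero _ this.symm
  -- The values of `p n` may lie outside the range of `T n` (point measures that are not simple),
  -- but by consistency only on a null set. So `q n` is a measurable version with values in `B n`.
  let q : ∀ n, B (n + 1) → B n := fun n => (hT n).invFun ∘ (hp n).mk
  have hq : ∀ n, Measurable (q n) := fun n =>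
    (hT n).measurable_invFun.comp (hp n).measurable_mk
  have hqp : ∀ n, ∀ᵐ b ∂(ξ (n + 1)), T n (q n b) = p n b := fun n => by
    have h1 : ∀ᵐ y ∂((ξ (n + 1)).map (p n)), y ∈ range (T n) := by
      rw [hcons, (hT n).ae_map_iff]
      exact Eventually.of_forall fun x => mem_range_self x
    filter_upwards [ae_of_ae_map (hp n) h1, (hp n).ae_eq_mk] with b ⟨x, hx⟩ hb
    simp only [q, Function.comp_apply]
    rw [← hb, ← hx, (hT n).apply_invFun]
  have hmap : ∀ n, (ξ (n + 1)).map (q n) = ξ n := fun n => by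
    refine (hT n).map_injective ?_
    rw [Measure.map_map (hT n).measurable (hq n), ← hcons]
    exact Measure.map_congr (hqp n)
  refine existsUnique_of_exists_of_unique ?_ ?_
  · obtain ⟨Q, hQ, marg, hcon⟩ := exists_measure_inverseLimit ξ q hq hmap
    have good : ∀ᵐ x ∂Q, ∀ n, p n (x (n + 1)) = T n (x n) := by
      refine ae_all_iff.mpr fun n => ?_
      have h := hqp n
      rw [← marg (n + 1)] at h
      filter_upwards [ae_of_ae_map (measurable_pi_apply _).aemeasurable h, hcon n] with x h1 h2
      rw [h2, h1]
    obtain ⟨G, hG, hGm, hGood⟩ := good.exists_measurable_mem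
    obtain ⟨x₀, hx₀⟩ : G.Nonempty := nonempty_of_mem hG
    have : Nonempty C := (glue x₀ (hGood x₀ hx₀)).nonempty
    choose! Ψ₀ hΨ₀ using glue
    classical
    -- The choice of glued points has no regularity of its own. Only `π n ∘ Ψ` must be measurable,
    -- and on `G` this is a coordinate followed by `T n`.
    let Ψ : (∀ n, B n) → C := G.piecewise Ψ₀ fun _ => Ψ₀ x₀
    have hπΨ : ∀ n, π n ∘ Ψ = G.piecewise (fun x => T n (x n)) fun _ => T n (x₀ n) := fun n => by
      funext x
      by_cases hx : x ∈ G
      · simp [Ψ, hx, hΨ₀ _ (hGood x hx)]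
      · simp [Ψ, hx, hΨ₀ _ (hGood x₀ hx₀)]
    have hπΨm : ∀ n, Measurable (π n ∘ Ψ) := fun n => by
      rw [hπΨ]
      exact Measurable.piecewise hGm ((hT n).measurable.comp (measurable_pi_apply n))
        measurable_const
    have hΨ : Measurable Ψ := by
      rw [measurable_iff_comap_le, hmC, MeasurableSpace.comap_iSup]
      refine iSup_le fun n => ?_
      rw [MeasurableSpace.comap_comp]
      exact (hπΨm n).comap_le
    refine ⟨Q.map Ψ, Measure.isProbabilityMeasure_map hΨ.aemeasurable, fun n => ?_⟩
    rw [Measure.map_map (hπ n) hΨ, ← marg n,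
      Measure.map_map (hT n).measurable (measurable_pi_apply n)]
    refine Measure.map_congr ?_
    filter_upwards [hG] with x hx
    rw [hπΨ]
    simp [hx]
  -- Uniqueness: `r n` recovers the projection at level `n` from that at level `n + 1` almost
  -- surely, for every solution `P`, and `H n k` iterates this from level `n + k`.
  · let r : ℕ → M → M := fun n => T n ∘ q n ∘ (hT (n + 1)).invFun
    have hr : ∀ n, Measurable (r n) := fun n =>
      (hT n).measurable.comp ((hq n).comp (hT (n + 1)).measurable_invFun)
    let H : ℕ → ℕ → M → M := fun n k => Nat.rec id (fun k h => h ∘ r (n + k)) k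
    have hH : ∀ n k, Measurable (H n k) := fun n k => by
      induction k with
      | zero => exact measurable_id
      | succ k ih => exact ih.comp (hr (n + k))
    have step : ∀ P : Measure C, (∀ n, P.map (π n) = (ξ n).map (T n)) → ∀ n,
        ∀ᵐ c ∂P, π n c = r n (π (n + 1) c) := fun P hP n => by
      have h : ∀ᵐ y ∂(P.map (π (n + 1))), ∃ b, y = T (n + 1) b ∧ T n (q n b) = p n b := by
        rw [hP, (hT _).ae_map_iff]
        filter_upwards [hqp n] with b hb using ⟨b, rfl, hb⟩
      filter_upwards [ae_of_ae_map (hπ _).aemeasurable h] with c ⟨b, hb, hb'⟩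
      rw [compat c n b hb, ← hb', hb]
      simp only [r, Function.comp_apply, (hT (n + 1)).apply_invFun]
    have steps : ∀ P : Measure C, (∀ n, P.map (π n) = (ξ n).map (T n)) → ∀ n k,
        ∀ᵐ c ∂P, π n c = H n k (π (n + k) c) := fun P hP n k => by
      induction k with
      | zero => exact Eventually.of_forall fun c => rfl
      | succ k ih =>
        filter_upwards [ih, step P hP (n + k)] with c h1 h2
        rw [h1, h2]
        rfl
    let Φ : C → ℕ → M := fun c n => π n c
    have hΦ : Measurable Φ := measurable_pi_iff.mpr hπ
    have hmΦ : mC = MeasurableSpace.comap Φ MeasurableSpace.pi := by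
      rw [hmC, MeasurableSpace.pi, MeasurableSpace.comap_iSup]
      simp only [MeasurableSpace.comap_comp]
      rfl
    -- All coordinates in `I` are functions of the one with the largest index, whose law is
    -- prescribed.
    have law : ∀ P : Measure C, (∀ n, P.map (π n) = (ξ n).map (T n)) → ∀ I : Finset ℕ,
        (P.map Φ).map I.restrict = ((ξ (I.sup id)).map (T (I.sup id))).map
          fun y (i : I) => H i (I.sup id - i) y := fun P hP I => by
      rw [← hP, Measure.map_map (measurable_pi_iff.mpr fun i => hH _ _) (hπ _),
        Measure.map_map (Finset.measurable_restrict I) hΦ]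
      refine Measure.map_congr ?_
      filter_upwards [ae_all_iff.mpr fun n => ae_all_iff.mpr fun k => steps P hP n k] with c hc
      funext i
      have hi : (i : ℕ) ≤ I.sup id := Finset.le_sup (f := id) i.2
      have := hc i (I.sup id - i)
      rw [Nat.add_sub_cancel' hi] at this
      exact this
    rintro P P' ⟨hP1, hP⟩ ⟨hP1', hP'⟩
    have hΦP : P.map Φ = P'.map Φ := by
      have : IsProbabilityMeasure (P.map Φ) := Measure.isProbabilityMeasure_map hΦ.aemeasurable
      refine IsProjectiveLimit.unique (P := fun I => (P.map Φ).map I.restrict)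
        (fun I => rfl) fun I => ?_
      exact (law P' hP' I).trans (law P hP I).symm
    ext s hs
    have hs' : MeasurableSet[MeasurableSpace.comap Φ MeasurableSpace.pi] s := hmΦ ▸ hs
    obtain ⟨t, ht, rfl⟩ := hs'
    rw [← Measure.map_apply hΦ ht, hΦP, Measure.map_apply hΦ ht]

end ProjectiveExtension

namespace BoseGas

variable {d : ℕ} {β : ℝ}

/-! ### Paths -/

instance : PolishSpace (LegPath d β) :=
  inferInstanceAs (PolishSpace (Σ k : ℕ+, C(Icc (0 : ℝ) ((k : ℝ) * β), Space d)))

theorem LegPath.measurable_length : Measurable fun f : LegPath d β => f.length := by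
  have : Continuous fun f : LegPath d β => f.length :=
    continuous_sigma fun k => (continuous_const : Continuous fun _ => (k : ℕ))
  exact this.measurable

variable [hβ : Fact (0 < β)]

theorem LegPath.eval_of_mem (f : LegPath d β) {t : ℝ} (ht : t ∈ Icc 0 f.duration) :
    f.eval t = f.2 ⟨t, ht⟩ :=
  congrArg f.2 (projIcc_of_mem _ ht)

theorem LegPath.continuous_eval (f : LegPath d β) : Continuous f.eval :=
  f.2.continuous.comp continuous_projIcc

theorem LegPath.eval_of_nonpos (f : LegPath d β) {t : ℝ} (ht : t ≤ 0) : f.eval t = f.eval 0 := by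
  unfold LegPath.eval
  rw [projIcc_of_le_left _ ht, projIcc_left]

theorem LegPath.eval_of_duration_le (f : LegPath d β) {t : ℝ} (ht : f.duration ≤ t) :
    f.eval t = f.eval f.duration := by
  unfold LegPath.eval
  exact congrArg f.2 ((projIcc_of_right_le _ ht).trans (projIcc_right ..).symm)

theorem LegPath.ext {f g : LegPath d β} (h : f.length = g.length)
    (he : ∀ t ∈ Icc 0 f.duration, f.eval t = g.eval t) : f = g := by
  obtain ⟨k, f⟩ := f
  obtain ⟨l, g⟩ := g
  obtain rfl : k = l := PNat.coe_injective h
  congr 1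
  ext1 t
  exact (LegPath.eval_of_mem ⟨k, f⟩ t.2).symm.trans
    ((he t t.2).trans (LegPath.eval_of_mem ⟨k, g⟩ t.2))

/-- The piece of the continuous function `g` on `[aβ, (a + n)β]`, shifted in time. -/
def LegPath.cut (g : C(ℝ, Space d)) (a : ℤ) (n : ℕ+) : LegPath d β :=
  ⟨n, ⟨fun t => g (a * β + t), by fun_prop⟩⟩

theorem LegPath.isPiece_cut (g : C(ℝ, Space d)) (a : ℤ) (n : ℕ+) :
    IsPiece g a (LegPath.cut g a n : LegPath d β) := fun t ht => by
  rw [LegPath.eval_of_mem _ ht]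
  rfl

/-- A time that depends only on the length of the path gives a continuous evaluation. -/
theorem LegPath.continuous_eval_time (τ : LegPath d β → ℝ)
    (hτ : ∀ k : ℕ+, ∃ t, ∀ f : C(Icc (0 : ℝ) ((k : ℝ) * β), Space d), τ ⟨k, f⟩ = t) :
    Continuous fun f : LegPath d β => f.eval (τ f) := by
  refine continuous_sigma fun k => ?_
  obtain ⟨t, ht⟩ := hτ k
  have : (fun f : C(Icc (0 : ℝ) ((k : ℝ) * β), Space d) =>
      LegPath.eval (⟨k, f⟩ : LegPath d β) (τ ⟨k, f⟩)) = fun f => f (projIcc 0 ((k : ℝ) * β)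
    (mul_nonneg (Nat.cast_nonneg (k : ℕ)) hβ.out.le) t) := by
    funext f
    rw [ht]
    rfl
  rw [this]
  exact continuous_eval_const _

theorem LegPath.measurable_eval (t : ℝ) : Measurable fun f : LegPath d β => f.eval t :=
  (LegPath.continuous_eval_time _ fun _ => ⟨t, fun _ => rfl⟩).measurable

theorem LegPath.measurable_eval_duration :
    Measurable fun f : LegPath d β => f.eval f.duration :=
  (LegPath.continuous_eval_time _ fun k => ⟨(k : ℕ) * β, fun _ => rfl⟩).measurable

theorem measurableSet_isShred {W : Set (Space d)} (hW : MeasurableSet W) :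
    MeasurableSet {s : LegPath d β | IsShred W s} := by
  refine (measurableSet_le measurable_const LegPath.measurable_length).inter
    (((LegPath.measurable_eval 0) hW.compl).inter
      ((LegPath.measurable_eval_duration hW.compl).inter ?_))
  change MeasurableSet {s : LegPath d β | ∀ j : ℕ, 1 ≤ j → j < s.length → s.eval (j * β) ∈ W}
  simp only [ofPred_forall]
  refine MeasurableSet.iInter fun j => MeasurableSet.iInter fun _ => ?_
  have : {s : LegPath d β | j < s.length → s.eval (j * β) ∈ W} =
      {s | j < s.length}ᶜ ∪ {s | s.eval (j * β) ∈ W} := by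
    ext s
    simp only [mem_ofPred_eq, mem_union, mem_compl_iff]
    tauto
  rw [this]
  exact (measurableSet_lt measurable_const LegPath.measurable_length).compl.union
    (LegPath.measurable_eval _ hW)

/-! ### Loops -/

theorem RootedLoop.ext_eval {f g : RootedLoop d β} (h : f.1.length = g.1.length)
    (he : ∀ t, f.periodic t = g.periodic t) : f = g := by
  have hd : f.1.duration = g.1.duration := by simp [LegPath.duration, h]
  have key : ∀ (f : RootedLoop d β), ∀ t ∈ Ico 0 f.1.duration, f.periodic t = f.1.eval t := by
    intro f t ht
    unfold RootedLoop.periodic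
    rw [(toIcoMod_eq_self f.1.duration_pos).mpr (by simpa using ht)]
  refine Subtype.ext (LegPath.ext h fun t ht => ?_)
  -- The end time is excluded from the fundamental period; there the closing condition of the loop
  -- is used.
  rcases ht.2.eq_or_lt with rfl | hlt
  · rw [← f.2, hd, ← g.2, ← key f 0 ⟨le_rfl, f.1.duration_pos⟩, he,
      key g 0 ⟨le_rfl, g.1.duration_pos⟩]
  · rw [← key f t ⟨ht.1, hlt⟩, he, key g t ⟨ht.1, hd ▸ hlt⟩]

@[simp]
theorem RootedLoop.periodic_zero (f : RootedLoop d β) : f.periodic 0 = f.1.eval 0 := by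
  unfold RootedLoop.periodic
  rw [toIcoMod_apply_left]

theorem RootedLoop.continuous_periodic (f : RootedLoop d β) : Continuous f.periodic := by
  have : Fact (0 < f.1.duration) := ⟨f.1.duration_pos⟩
  have h := AddCircle.liftIco_continuous (p := f.1.duration) (a := 0) (f := f.1.eval)
    (by rw [zero_add]; exact f.2) f.1.continuous_eval.continuousOn
  have h2 : f.periodic = fun t : ℝ => AddCircle.liftIco f.1.duration 0 f.1.eval t := by
    funext t
    unfold RootedLoop.periodic
    have ht : ((toIcoMod f.1.duration_pos 0 t : ℝ) : AddCircle f.1.duration) = t := by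
      rw [← self_sub_toIcoDiv_zsmul, AddCircle.coe_sub, AddCircle.coe_zsmul,
        AddCircle.coe_period, smul_zero, sub_zero]
    rw [← ht, AddCircle.liftIco_coe_apply (toIcoMod_mem_Ico _ _ _)]
  rw [h2]
  exact h.comp (AddCircle.continuous_mk' _)

theorem RootedLoop.periodic_add_mul (f : RootedLoop d β) (t : ℝ) (j : ℤ) :
    f.periodic (t + (j * f.1.length : ℤ) * β) = f.periodic t := by
  unfold RootedLoop.periodic
  congr 1
  have : t + (j * f.1.length : ℤ) * β = t + j • f.1.duration := by
    simp [LegPath.duration]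
    ring
  rw [this, toIcoMod_add_zsmul]

theorem RootedLoop.measurable_periodic (t : ℝ) :
    Measurable fun f : RootedLoop d β => f.periodic t := by
  have : Measurable fun f : LegPath d β => f.eval (toIcoMod f.duration_pos 0 t) :=
    (LegPath.continuous_eval_time _ fun k =>
      ⟨toIcoMod (mul_pos (Nat.cast_pos.mpr k.pos) hβ.out) 0 t, fun _ => rfl⟩).measurable
  exact this.comp measurable_subtype_coe

instance : StandardBorelSpace (RootedLoop d β) :=
  MeasurableSet.standardBorel
    (measurableSet_eq_fun (LegPath.measurable_eval 0) LegPath.measurable_eval_duration)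

theorem RootedLoop.exists_shift (f : RootedLoop d β) (j : ℤ) :
    ∃ g : RootedLoop d β, g.1.length = f.1.length ∧ ∀ t, g.periodic t = f.periodic (t + j * β) := by
  let s : LegPath d β := LegPath.cut ⟨f.periodic, f.continuous_periodic⟩ j f.1.1
  have hs : ∀ t ∈ Icc 0 s.duration, s.eval t = f.periodic (j * β + t) :=
    LegPath.isPiece_cut ⟨f.periodic, f.continuous_periodic⟩ j f.1.1
  have hd : s.duration = f.1.length * β := rfl
  have h0 : s.eval 0 = s.eval s.duration := by
    rw [hs _ ⟨le_rfl, s.duration_pos.le⟩, hs _ ⟨s.duration_pos.le, le_rfl⟩, hd,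
      f.periodic_add, add_zero]
  refine ⟨⟨s, h0⟩, rfl, fun t => ?_⟩
  unfold RootedLoop.periodic
  have ht := toIcoMod_mem_Ico s.duration_pos 0 t
  rw [zero_add] at ht
  rw [hs _ ⟨ht.1, ht.2.le⟩]
  have := f.periodic_add_mul (j * β + toIcoMod s.duration_pos 0 t)
    (toIcoDiv s.duration_pos 0 t)
  change _ = f.periodic _
  rw [← this]
  congr 1
  have ht' := toIcoMod_add_toIcoDiv_zsmul s.duration_pos 0 t
  rw [zsmul_eq_mul] at ht'
  push_cast
  linear_combination ht' - (toIcoDiv s.duration_pos 0 t : ℝ) * hd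

/-- A real number that encodes the path of the loop `f`, seen from time `jβ` on. -/
def RootedLoop.code (j : ℤ) (f : RootedLoop d β) : ℝ :=
  embeddingReal (ℚ → Space d) fun q => f.periodic (q * β + j * β)

theorem RootedLoop.measurable_code (j : ℤ) :
    Measurable (RootedLoop.code j : RootedLoop d β → ℝ) :=
  (measurable_embeddingReal _).comp
    (measurable_pi_iff.mpr fun _ => RootedLoop.measurable_periodic _)

theorem RootedLoop.code_eq_of_shift {f g : RootedLoop d β} {j : ℤ}
    (h : ∀ t, g.periodic t = f.periodic (t + j * β)) (i : ℤ) : g.code i = f.code (i + j) := by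
  unfold RootedLoop.code
  congr 1
  funext q
  rw [h]
  congr 1
  push_cast
  ring

/-- The code records the values at rational multiples of `β`, which are dense, and the loops are
continuous. -/
theorem RootedLoop.shift_of_code_eq {f g : RootedLoop d β} {i j : ℤ} (h : g.code i = f.code j)
    (t : ℝ) : g.periodic (t + i * β) = f.periodic (t + j * β) := by
  have hq := congrFun ((measurableEmbedding_embeddingReal _).injective h)
  have hd : DenseRange fun q : ℚ => (q : ℝ) * β :=
    (mul_right_surjective₀ hβ.out.ne').denseRange.comp Rat.denseRange_cast (by fun_prop)
  exact congrFun (hd.equalizer (g.continuous_periodic.comp (continuous_add_const _))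
    (f.continuous_periodic.comp (continuous_add_const _)) (funext hq)) t

/-- Codes are periodic in the shift, with the length as a period, so they take finitely many values
and minima are attained on any nonempty set of shifts. -/
theorem RootedLoop.exists_code_le (f : RootedLoop d β) {J : Set ℤ} (hJ : J.Nonempty) :
    ∃ i ∈ J, ∀ j ∈ J, f.code i ≤ f.code j := by
  have hfin : ((fun j => f.code j) '' J).Finite := by
    refine ((Finset.Ico (0 : ℤ) f.1.length).finite_toSet.image fun j => f.code j).subset ?_
    rintro _ ⟨j, -, rfl⟩
    have hL : (0 : ℤ) < f.1.length := by exact_mod_cast f.1.length_pos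
    refine ⟨j % f.1.length, ?_, ?_⟩
    · simpa using ⟨Int.emod_nonneg _ hL.ne', Int.emod_lt_of_pos _ hL⟩
    · have h : ∀ t, f.periodic t = f.periodic (t + ((j / f.1.length) * f.1.length : ℤ) * β) :=
        fun t => (f.periodic_add_mul t _).symm
      have := RootedLoop.code_eq_of_shift h (j % f.1.length)
      beta_reduce
      rw [this, Int.emod_add_ediv_mul]
  obtain ⟨_, ⟨i, hi, rfl⟩, h⟩ := exists_min_image _ id hfin (hJ.image _)
  exact ⟨i, hi, fun j hj => h _ ⟨j, hj, rfl⟩⟩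

/-- The length of a loop, together with the least of the codes of its shifts. -/
def Loop.code : Loop d β → ℕ × EReal :=
  Quotient.lift (fun f : RootedLoop d β => (f.1.length, ⨅ j : ℤ, (f.code j : EReal))) (by
    rintro f g ⟨hl, j, hj⟩
    refine Prod.ext hl ?_
    simp only [RootedLoop.code_eq_of_shift hj]
    exact ((Equiv.addRight j).iInf_comp (g := fun i => (f.code i : EReal))).symm)

theorem Loop.measurable_code : Measurable (Loop.code : Loop d β → ℕ × EReal) :=
  measurable_from_quotient.mpr <|
    (LegPath.measurable_length.comp measurable_subtype_coe).prodMk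
      (Measurable.iInf fun j => (RootedLoop.measurable_code j).coe_real_ereal)

/-- The infimum is attained, so equal codes mean that some shift of one loop coincides with some
shift of the other. -/
theorem Loop.code_injective : Function.Injective (Loop.code : Loop d β → ℕ × EReal) := by
  rintro ⟨f⟩ ⟨g⟩ h
  refine Quotient.sound ?_
  obtain ⟨h1, h2⟩ := Prod.ext_iff.mp h
  have hmin : ∀ f : RootedLoop d β, ∃ i, (⨅ j : ℤ, (f.code j : EReal)) = f.code i := by
    intro f
    obtain ⟨i, -, hi⟩ := f.exists_code_le univ_nonempty
    exact ⟨i, le_antisymm (iInf_le _ i) (le_iInf fun j => EReal.coe_le_coe (hi j trivial))⟩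
  obtain ⟨i, hi⟩ := hmin f
  obtain ⟨j, hj⟩ := hmin g
  have hc : g.code j = f.code i := by
    have : ((f.code i : ℝ) : EReal) = g.code j := hi.symm.trans (h2.trans hj)
    exact_mod_cast this.symm
  refine ⟨h1, i - j, fun t => ?_⟩
  have := RootedLoop.shift_of_code_eq hc (t - j * β)
  rw [sub_add_cancel] at this
  rw [this]
  congr 1
  push_cast
  ring

/-- The rooted loops that have the least code among all their shifts with the same root. -/
def canonicalLoops (d : ℕ) (β : ℝ) [Fact (0 < β)] : Set (RootedLoop d β) :=
  {f | ∀ j : ℤ, f.periodic (j * β) = f.1.eval 0 → f.code 0 ≤ f.code j}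

theorem measurableSet_canonicalLoops : MeasurableSet (canonicalLoops d β) := by
  unfold canonicalLoops
  simp only [ofPred_forall]
  refine MeasurableSet.iInter fun j => ?_
  have : {f : RootedLoop d β | f.periodic (j * β) = f.1.eval 0 → f.code 0 ≤ f.code j} =
      {f | f.periodic (j * β) = f.1.eval 0}ᶜ ∪ {f | f.code 0 ≤ f.code j} := by
    ext f
    simp only [mem_ofPred_eq, mem_union, mem_compl_iff]
    tauto
  rw [this]
  exact (measurableSet_eq_fun (RootedLoop.measurable_periodic _)
    ((LegPath.measurable_eval 0).comp measurable_subtype_coe)).compl.union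
    (measurableSet_le (RootedLoop.measurable_code 0) (RootedLoop.measurable_code j))

/-- The canonical rooted loops are a measurable section. A mark does not determine the root time,
since the loop may revisit `x` at several multiples of `β`; the least code settles the choice. -/
instance : StandardBorelSpace (MarkedLoop d β) := by
  have : MeasurableSpace.CountablySeparated (MarkedLoop d β) :=
    countablySeparated_of_injective (f := fun p => (p.1.1, p.1.2.code))
      ((measurable_fst.prodMk (Loop.measurable_code.comp measurable_snd)).comp
        measurable_subtype_coe)
      fun p q h => Subtype.ext <| Prod.ext (Prod.ext_iff.mp h).1
        (Loop.code_injective (Prod.ext_iff.mp h).2)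
  have := measurableSet_canonicalLoops (d := d) (β := β) |>.standardBorel
  refine standardBorelSpace_of_bijective
    (f := fun f : canonicalLoops d β =>
      (⟨(f.1.1.eval 0, Quotient.mk _ f.1), f.1, rfl, rfl⟩ : MarkedLoop d β)) ?_ ⟨?_, ?_⟩
  · refine Measurable.subtype_mk (Measurable.prodMk ?_ ?_)
    · exact (LegPath.measurable_eval 0).comp (measurable_subtype_coe.comp measurable_subtype_coe)
    · exact measurable_quotient_mk''.comp measurable_subtype_coe
  · rintro ⟨f, hf⟩ ⟨g, hg⟩ h
    obtain ⟨h1, h2⟩ := Prod.ext_iff.mp (Subtype.ext_iff.mp h)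
    obtain ⟨hl, j, hj⟩ : f ≈ g := Quotient.exact h2
    dsimp only at h1
    have hle : ∀ f g : RootedLoop d β, f ∈ canonicalLoops d β → f.1.eval 0 = g.1.eval 0 →
        ∀ j : ℤ, (∀ t, g.periodic t = f.periodic (t + j * β)) → f.code 0 ≤ g.code 0 := by
      intro f g hf h j hj
      rw [RootedLoop.code_eq_of_shift hj, zero_add]
      refine hf j ?_
      rw [h, ← g.periodic_zero, hj, zero_add]
    have hj' : ∀ t, f.periodic t = g.periodic (t + (-j : ℤ) * β) := fun t => by
      rw [hj]
      congr 1
      push_cast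
      ring
    have hc := le_antisymm (hle f g hf h1 j hj) (hle g f hg h1.symm (-j) hj')
    refine Subtype.ext (RootedLoop.ext_eval hl fun t => ?_)
    simpa using RootedLoop.shift_of_code_eq hc t
  · rintro ⟨⟨x, l⟩, f, hfl, hfx⟩
    dsimp only at hfl hfx
    subst hfl hfx
    obtain ⟨i, hi, hmin⟩ := f.exists_code_le (J := {j | f.periodic (j * β) = f.1.eval 0})
      ⟨0, by simp⟩
    obtain ⟨g, hgl, hg⟩ := f.exists_shift i
    have hg0 : g.1.eval 0 = f.1.eval 0 := by
      rw [← g.periodic_zero, hg, zero_add]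
      exact hi
    refine ⟨⟨g, fun j hj => ?_⟩, ?_⟩
    · rw [RootedLoop.code_eq_of_shift hg, RootedLoop.code_eq_of_shift hg, zero_add]
      refine hmin _ ?_
      rw [hg, ← add_mul, hg0] at hj
      simpa using hj
    · refine Subtype.ext (Prod.ext hg0 (Quotient.sound ?_))
      exact Setoid.symm (⟨hgl.symm, i, hg⟩ : f ≈ g)

theorem measurableSet_allIn {W : Set (Space d)} (hW : MeasurableSet W) :
    MeasurableSet {p : MarkedLoop d β | p.1.2.AllIn W} := by
  have : MeasurableSet {l : Loop d β | l.AllIn W} := by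
    refine measurableSet_quotient.mpr ?_
    change MeasurableSet {f : RootedLoop d β | ∀ k : ℤ, f.periodic (k * β) ∈ W}
    simp only [ofPred_forall]
    exact MeasurableSet.iInter fun k => RootedLoop.measurable_periodic _ hW
  exact measurable_snd.comp measurable_subtype_coe this

end BoseGas

namespace BoseGas

/-! ### Finite simple point measures -/

section PointMeasure

variable {X : Type*} [MeasurableSpace X]

theorem pointMeasure_apply (Γ : Set X) {A : Set X} (hA : MeasurableSet A) :
    pointMeasure Γ A = ∑' p : Γ, A.indicator 1 (p : X) := by
  unfold pointMeasure
  rw [Measure.sum_apply _ hA]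
  exact tsum_congr fun p => Measure.dirac_apply' _ hA

theorem pointMeasure_singleton [MeasurableSingletonClass X] (Γ : Set X) (x : X) :
    pointMeasure Γ {x} = Γ.indicator 1 x := by
  classical
  rw [pointMeasure_apply _ (measurableSet_singleton x),
    tsum_subtype Γ (fun p => ({x} : Set X).indicator (1 : X → ENNReal) p),
    tsum_eq_single x]
  · by_cases hx : x ∈ Γ <;> simp [hx]
  · intro y hy
    by_cases hyΓ : y ∈ Γ <;> simp [hyΓ, hy]

theorem pointMeasure_injective [MeasurableSingletonClass X] :
    Function.Injective (pointMeasure : Set X → Measure X) := fun Γ Γ' h => by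
  ext x
  have hx := congrArg (fun μ : Measure X => μ {x}) h
  simp only [pointMeasure_singleton] at hx
  by_cases h1 : x ∈ Γ <;> by_cases h2 : x ∈ Γ' <;> simp_all

theorem pointMeasure_univ_lt_top {Γ : Set X} (hΓ : Γ.Finite) : pointMeasure Γ univ < ⊤ := by
  have := hΓ.fintype
  rw [pointMeasure_apply _ MeasurableSet.univ, tsum_fintype]
  exact ENNReal.sum_lt_top.mpr fun p _ => by simp

theorem pointMeasure_range {ι : Type*} [Fintype ι] {v : ι → X} (hv : Function.Injective v)
    {A : Set X} (hA : MeasurableSet A) :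
    pointMeasure (range v) A = ∑ i, A.indicator 1 (v i) := by
  rw [pointMeasure_apply _ hA, ← (Equiv.ofInjective v hv).tsum_eq, tsum_fintype]
  rfl

variable (X) in
/-- Enumerations of the finite subsets of `S`, in increasing order with respect to an embedding into
the real numbers. -/
def Enumeration [StandardBorelSpace X] (S : Set X) : Type _ :=
  {z : Σ n : ℕ, (Fin n → X) // StrictMono (fun i => embeddingReal X (z.2 i)) ∧ ∀ i, z.2 i ∈ S}

variable [StandardBorelSpace X] {S : Set X}

instance : MeasurableSpace (Enumeration X S) :=
  inferInstanceAs (MeasurableSpace {z : Σ n : ℕ, (Fin n → X) //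
    StrictMono (fun i => embeddingReal X (z.2 i)) ∧ ∀ i, z.2 i ∈ S})

theorem Enumeration.standardBorelSpace (hS : MeasurableSet S) :
    StandardBorelSpace (Enumeration X S) := by
  refine MeasurableSet.standardBorel (MeasurableSpace.measurableSet_iInf.mpr fun n => ?_)
  change MeasurableSet {v : Fin n → X | StrictMono (fun i => embeddingReal X (v i)) ∧ ∀ i, v i ∈ S}
  refine MeasurableSet.inter ?_ ?_
  · change MeasurableSet {v : Fin n → X |
      ∀ i j, i < j → embeddingReal X (v i) < embeddingReal X (v j)}
    simp only [ofPred_forall]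
    exact MeasurableSet.iInter fun i => MeasurableSet.iInter fun j => MeasurableSet.iInter fun _ =>
      measurableSet_lt ((measurable_embeddingReal X).comp (measurable_pi_apply i))
        ((measurable_embeddingReal X).comp (measurable_pi_apply j))
  · change MeasurableSet {v : Fin n → X | ∀ i, v i ∈ S}
    simp only [ofPred_forall]
    exact MeasurableSet.iInter fun i => measurable_pi_apply i hS

/-- The enumerated set. -/
def Enumeration.toSet (z : Enumeration X S) : Set X := range z.1.2

theorem Enumeration.injective (z : Enumeration X S) : Function.Injective z.1.2 := fun _ _ h =>
  z.2.1.injective (congrArg (embeddingReal X) h)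

/-- A strictly increasing sequence of reals is determined by its range. -/
theorem Enumeration.toSet_injective :
    Function.Injective (Enumeration.toSet : Enumeration X S → Set X) := by
  rintro ⟨⟨n, v⟩, hv⟩ ⟨⟨m, w⟩, hw⟩ h
  have h' : range v = range w := h
  obtain rfl : n = m := by
    have hn := Nat.card_range_of_injective (Enumeration.injective ⟨⟨n, v⟩, hv⟩)
    have hm := Nat.card_range_of_injective (Enumeration.injective ⟨⟨m, w⟩, hw⟩)
    dsimp only at hn hm
    rw [h'] at hn
    simpa using hn.symm.trans hm
  have : (fun i => embeddingReal X (v i)) = fun i => embeddingReal X (w i) := by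
    refine (StrictMono.range_inj hv.1 hw.1).mp ?_
    change range (embeddingReal X ∘ v) = range (embeddingReal X ∘ w)
    rw [range_comp, range_comp, h']
  obtain rfl : v = w := funext fun i =>
    (measurableEmbedding_embeddingReal X).injective (congrFun this i)
  rfl

theorem Enumeration.exists_toSet_eq {Γ : Set X} (hΓ : Γ.Finite) (hS : Γ ⊆ S) :
    ∃ z : Enumeration X S, z.toSet = Γ := by
  classical
  set e := embeddingReal X
  have he : Function.Injective e := (measurableEmbedding_embeddingReal X).injective
  let F : Finset ℝ := hΓ.toFinset.image e
  have hF : ∀ i : Fin F.card, ∃ x ∈ Γ, e x = F.orderEmbOfFin rfl i := fun i => by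
    obtain ⟨x, hx, hxe⟩ := Finset.mem_image.mp (F.orderEmbOfFin_mem rfl i)
    exact ⟨x, hΓ.mem_toFinset.mp hx, hxe⟩
  choose v hv hev using hF
  refine ⟨⟨⟨F.card, v⟩, ?_, fun i => hS (hv i)⟩, ?_⟩
  · change StrictMono fun i => e (v i)
    simp only [hev]
    exact (F.orderEmbOfFin rfl).strictMono
  · refine subset_antisymm (range_subset_iff.mpr hv) fun x hx => ?_
    have : e x ∈ range (F.orderEmbOfFin rfl) := by
      rw [Finset.range_orderEmbOfFin]
      simpa [F] using ⟨x, hx, rfl⟩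
    obtain ⟨i, hi⟩ := this
    exact ⟨i, he ((hev i).trans hi)⟩

theorem Enumeration.measurable_pointMeasure :
    Measurable fun z : Enumeration X S => pointMeasure z.toSet := by
  refine Measure.measurable_of_measurable_coe _ fun A hA => ?_
  have h : Measurable fun z : Σ n : ℕ, (Fin n → X) =>
      ∑ i, A.indicator (1 : X → ENNReal) (z.2 i) :=
    measurable_sigma_iff.mpr fun n => Finset.measurable_sum Finset.univ
      (f := fun (i : Fin n) (v : Fin n → X) => A.indicator (1 : X → ENNReal) (v i)) fun i _ =>
      (measurable_one.indicator hA).comp (measurable_pi_apply i)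
  have h2 : (fun z : Enumeration X S => pointMeasure z.toSet A) =
      fun z => ∑ i, A.indicator (1 : X → ENNReal) (z.1.2 i) :=
    funext fun z => pointMeasure_range z.injective hA
  rw [h2]
  exact h.comp measurable_subtype_coe

end PointMeasure

/-! ### Configurations in a box -/

section BoxConfig

variable {d : ℕ} {β : ℝ} [Fact (0 < β)] {W : Set (Space d)}

theorem BoxConfig.ext {b c : BoxConfig β W} (hl : b.loops = c.loops) (hs : b.shreds = c.shreds) :
    b = c := by
  cases b
  cases c
  congr

instance : Nonempty (BoxConfig β W) :=
  ⟨⟨∅, ∅, finite_empty, finite_empty, fun _ h => h.elim, fun _ h => h.elim⟩⟩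

theorem BoxConfig.measurable_toMeasures :
    Measurable (BoxConfig.toMeasures : BoxConfig β W → _) :=
  comap_measurable _

theorem BoxConfig.toMeasures_injective :
    Function.Injective (BoxConfig.toMeasures : BoxConfig β W → _) := fun _ _ h =>
  BoxConfig.ext (pointMeasure_injective (Prod.ext_iff.mp h).1)
    (pointMeasure_injective (Prod.ext_iff.mp h).2)

theorem BoxConfig.toMeasures_finite (b : BoxConfig β W) :
    b.toMeasures ∈ ({μ | μ univ < ⊤} ×ˢ {μ | μ univ < ⊤} :
      Set (Measure (MarkedLoop d β) × Measure (LegPath d β))) :=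
  ⟨pointMeasure_univ_lt_top b.finite_loops, pointMeasure_univ_lt_top b.finite_shreds⟩

/-- The pair of finite measures that a configuration stands for. -/
def BoxConfig.toFiniteMeasures (b : BoxConfig β W) :
    ({μ | μ univ < ⊤} ×ˢ {μ | μ univ < ⊤} :
      Set (Measure (MarkedLoop d β) × Measure (LegPath d β))) :=
  ⟨b.toMeasures, b.toMeasures_finite⟩

instance finiteMeasurePairs_countablySeparated {X Y : Type*} [MeasurableSpace X]
    [StandardBorelSpace X] [MeasurableSpace Y] [StandardBorelSpace Y] :
    MeasurableSpace.CountablySeparated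
      ({μ | μ univ < ⊤} ×ˢ {μ | μ univ < ⊤} : Set (Measure X × Measure Y)) :=
  countablySeparated_of_injective (MeasurableEquiv.Set.prod _ _).measurable
    (MeasurableEquiv.Set.prod _ _).injective

theorem BoxConfig.measurable_toFiniteMeasures :
    Measurable (BoxConfig.toFiniteMeasures : BoxConfig β W → _) :=
  BoxConfig.measurable_toMeasures.subtype_mk

theorem BoxConfig.toFiniteMeasures_injective :
    Function.Injective (BoxConfig.toFiniteMeasures : BoxConfig β W → _) := fun _ _ h =>
  BoxConfig.toMeasures_injective (Subtype.ext_iff.mp h)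

theorem BoxConfig.standardBorelSpace (hW : MeasurableSet W) :
    StandardBorelSpace (BoxConfig β W) := by
  have := countablySeparated_of_injective (BoxConfig.measurable_toFiniteMeasures (β := β) (W := W))
    BoxConfig.toFiniteMeasures_injective
  have := Enumeration.standardBorelSpace (measurableSet_allIn (β := β) hW)
  have := Enumeration.standardBorelSpace (measurableSet_isShred (β := β) hW)
  let f : Enumeration (MarkedLoop d β) {p | p.1.2.AllIn W} ×
      Enumeration (LegPath d β) {s | IsShred W s} → BoxConfig β W := fun z =>
    ⟨z.1.toSet, z.2.toSet, finite_range _, finite_range _,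
      by rintro _ ⟨i, rfl⟩; exact z.1.2.2 i, by rintro _ ⟨i, rfl⟩; exact z.2.2.2 i⟩
  refine standardBorelSpace_of_bijective (f := f) ?_ ⟨?_, ?_⟩
  · refine measurable_comap_iff.mpr ?_
    exact (Enumeration.measurable_pointMeasure.comp measurable_fst).prodMk
      (Enumeration.measurable_pointMeasure.comp measurable_snd)
  · intro z w h
    exact Prod.ext (Enumeration.toSet_injective (congrArg BoxConfig.loops h))
      (Enumeration.toSet_injective (congrArg BoxConfig.shreds h))
  · intro b
    obtain ⟨z, hz⟩ := Enumeration.exists_toSet_eq b.finite_loops b.allIn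
    obtain ⟨w, hw⟩ := Enumeration.exists_toSet_eq b.finite_shreds b.isShred
    exact ⟨(z, w), BoxConfig.ext hz hw⟩

/-- Lusin–Souslin is applied with the pairs of finite measures as target, which are countably
separated and form a measurable subset of all pairs. -/
theorem BoxConfig.measurableEmbedding_toMeasures (hW : MeasurableSet W) :
    MeasurableEmbedding (BoxConfig.toMeasures : BoxConfig β W → _) := by
  have := BoxConfig.standardBorelSpace (β := β) hW
  have h := BoxConfig.measurable_toFiniteMeasures.measurableEmbedding
    (BoxConfig.toFiniteMeasures_injective (β := β) (W := W))
  refine (MeasurableEmbedding.subtype_coe ?_).comp h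
  exact (measurableSet_lt (Measure.measurable_coe MeasurableSet.univ) measurable_const).prod
    (measurableSet_lt (Measure.measurable_coe MeasurableSet.univ) measurable_const)

theorem measurableSet_box (R : ℕ+) : MeasurableSet (box d R) := by
  unfold box
  simp only [ofPred_forall]
  exact MeasurableSet.iInter fun i => measurableSet_le (by fun_prop) measurable_const

end BoxConfig

end BoseGas

namespace BoseGas

variable {d : ℕ} {β : ℝ} {W W' : Set (Space d)}

/-! ### Occurrences of shreds -/

/-- In both directions of time, `g` has particles outside of `W` that are arbitrarily far away. -/
def Exits (β : ℝ) (W : Set (Space d)) (g : ℝ → Space d) : Prop :=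
  ∀ z : ℤ, (∃ a ≤ z, g (a * β) ∉ W) ∧ ∃ a ≥ z, g (a * β) ∉ W

theorem Trajectory.exits {K : Set (Space d)} (hK : IsCompact K) (hW : W ⊆ K)
    (g : Trajectory d β) : Exits β W g.1 := fun z => by
  have hfin : {k : ℤ | g.1 (k * β) ∈ W}.Finite := (g.2 K hK).subset fun k hk => hW hk
  obtain ⟨a, ha, ha'⟩ := (Set.Iic_infinite z).exists_notMem_finite hfin
  obtain ⟨b, hb, hb'⟩ := (Set.Ici_infinite z).exists_notMem_finite hfin
  exact ⟨⟨a, ha, ha'⟩, ⟨b, hb, hb'⟩⟩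

variable [hβ : Fact (0 < β)]

/-- The `W`-shred `s` is the piece of `g` that begins at time `aβ`. -/
def Occurs (W : Set (Space d)) (g : ℝ → Space d) (a : ℤ) (s : LegPath d β) : Prop :=
  IsShred W s ∧ IsPiece g a s

theorem IsPiece.apply {g : ℝ → Space d} {a : ℤ} {s : LegPath d β} (h : IsPiece g a s) {k : ℤ}
    (h1 : a ≤ k) (h2 : k ≤ a + s.length) : s.eval ((k - a : ℤ) * β) = g (k * β) := by
  rw [h]
  · congr 1
    push_cast
    ring
  · have h3 : (0 : ℝ) ≤ (k - a : ℤ) := by exact_mod_cast sub_nonneg.mpr h1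
    have h4 : ((k - a : ℤ) : ℝ) ≤ s.length := by
      have : k - a ≤ (s.length : ℤ) := by lia
      exact_mod_cast this
    exact ⟨mul_nonneg h3 hβ.out.le, mul_le_mul_of_nonneg_right h4 hβ.out.le⟩

theorem IsShred.eval_zero {s : LegPath d β} (h : IsShred W s) : s.eval 0 ∉ W := h.2.1

theorem IsShred.eval_duration {s : LegPath d β} (h : IsShred W s) : s.eval s.duration ∉ W :=
  h.2.2.1

namespace Occurs

variable {g : ℝ → Space d} {a : ℤ} {s : LegPath d β}

theorem two_le (h : Occurs W g a s) : (2 : ℤ) ≤ s.length := by exact_mod_cast h.1.1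

theorem start_notMem (h : Occurs W g a s) : g (a * β) ∉ W := by
  rw [← h.2.apply le_rfl (by lia)]
  simpa using h.1.2.1

theorem end_notMem (h : Occurs W g a s) : g ((a + s.length : ℤ) * β) ∉ W := by
  rw [← h.2.apply (by lia) le_rfl]
  simpa [LegPath.duration] using h.1.2.2.1

theorem mem (h : Occurs W g a s) {k : ℤ} (h1 : a < k) (h2 : k < a + s.length) :
    g (k * β) ∈ W := by
  rw [← h.2.apply h1.le h2.le]
  have := h.1.2.2.2 (k - a).toNat (by lia) (by lia)
  have hk : (((k - a).toNat : ℤ) : ℝ) = (k - a : ℤ) := by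
    rw [Int.toNat_of_nonneg (by lia)]
  rwa [← hk]

theorem eq_of_same_start {t : LegPath d β} (hs : Occurs W g a s) (ht : Occurs W g a t) : s = t := by
  have hl : s.length = t.length := by
    have h1 := hs.two_le
    have h2 := ht.two_le
    rcases lt_trichotomy s.length t.length with h | h | h
    · exact absurd (ht.mem (k := a + s.length) (by lia) (by lia)) hs.end_notMem
    · exact h
    · exact absurd (hs.mem (k := a + t.length) (by lia) (by lia)) ht.end_notMem
  refine LegPath.ext hl fun u hu => ?_
  rw [hs.2 u hu, ht.2 u (by rwa [LegPath.duration, ← hl])]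

/-- The later of two distinct starts would be an interior time of the other shred, hence in `W`,
although starts are outside of `W`. -/
theorem start_eq {b : ℤ} {t : LegPath d β} (hs : Occurs W g a s) (ht : Occurs W g b t) {k : ℤ}
    (h1 : a ≤ k) (h2 : k < a + s.length) (h3 : b ≤ k) (h4 : k < b + t.length) : a = b := by
  rcases lt_trichotomy a b with h | h | h
  · exact absurd (hs.mem h (by lia)) ht.start_notMem
  · exact h
  · exact absurd (ht.mem h (by lia)) hs.start_notMem

theorem congr_piece {g' : ℝ → Space d} {a' : ℤ}
    (h : ∀ t ∈ Icc 0 s.duration, g (a * β + t) = g' (a' * β + t)) :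
    Occurs W g a s ↔ Occurs W g' a' s := by
  refine and_congr_right fun _ => forall₂_congr fun t ht => ?_
  rw [h t ht]

theorem _root_.BoseGas.IsPiece.occurs_iff {t : LegPath d β} {b : ℤ} (h : IsPiece g a t)
    (h1 : a ≤ b) (h2 : b + s.length ≤ a + t.length) :
    Occurs W t.eval (b - a) s ↔ Occurs W g b s := by
  refine congr_piece fun u hu => ?_
  have h3 : (0 : ℝ) ≤ (b - a : ℤ) := by exact_mod_cast sub_nonneg.mpr h1
  have h4 : ((b - a : ℤ) : ℝ) + s.length ≤ t.length := by
    have : b - a + s.length ≤ (t.length : ℤ) := by lia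
    exact_mod_cast this
  rw [h]
  · congr 1
    push_cast
    ring
  · refine ⟨add_nonneg (mul_nonneg h3 hβ.out.le) hu.1, ?_⟩
    calc ((b - a : ℤ) : ℝ) * β + u ≤ ((b - a : ℤ) : ℝ) * β + s.length * β := by
          gcongr
          exact hu.2
      _ = (((b - a : ℤ) : ℝ) + s.length) * β := by ring
      _ ≤ t.length * β := mul_le_mul_of_nonneg_right h4 hβ.out.le

/-- The path is extended by constants. A shred reaching beyond the window would have an interior
particle equal to an endpoint of `t`, which is not in `W`. -/
theorem window {t : LegPath d β} {b : ℤ} (h0 : t.eval 0 ∉ W) (h1 : t.eval t.duration ∉ W)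
    (hs : Occurs W t.eval b s) : 0 ≤ b ∧ b + s.length ≤ t.length := by
  have h2 := hs.two_le
  constructor
  · by_contra! hb
    refine h0 ?_
    have := hs.mem (k := b + 1) (by lia) (by lia)
    rwa [LegPath.eval_of_nonpos _ (mul_nonpos_of_nonpos_of_nonneg _ hβ.out.le)] at this
    exact_mod_cast (by lia : b + 1 ≤ 0)
  · by_contra! hb
    refine h1 ?_
    have := hs.mem (k := b + s.length - 1) (by lia) (by lia)
    rwa [LegPath.eval_of_duration_le _ (mul_le_mul_of_nonneg_right _ hβ.out.le)] at this
    exact_mod_cast (by lia : (t.length : ℤ) ≤ b + s.length - 1)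

theorem trans (hW : W ⊆ W') {t : LegPath d β} {b : ℤ} (ht : Occurs W' g a t)
    (hs : Occurs W t.eval b s) :
    0 ≤ b ∧ b + s.length ≤ t.length ∧ Occurs W g (a + b) s := by
  obtain ⟨h1, h2⟩ := hs.window (fun h => ht.1.eval_zero (hW h))
    (fun h => ht.1.eval_duration (hW h))
  refine ⟨h1, h2, ?_⟩
  rw [← ht.2.occurs_iff (by lia) (by lia)]
  simpa using hs

end Occurs

/-- The shred runs from the last particle outside of `W` before `k` to the first one after `k`. -/
theorem exists_occurs_of_mem {g : ℝ → Space d} (hg : Continuous g) (hW : Exits β W g) {k : ℤ}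
    (hk : g (k * β) ∈ W) :
    ∃ (a : ℤ) (s : LegPath d β), Occurs W g a s ∧ a < k ∧ k < a + s.length := by
  obtain ⟨a, ⟨hak, ha⟩, hamax⟩ := Int.exists_greatest_of_bdd
    (P := fun a => a ≤ k ∧ g (a * β) ∉ W) ⟨k, fun _ h => h.1⟩ (hW k).1
  obtain ⟨e, ⟨hek, he⟩, hemin⟩ := Int.exists_least_of_bdd
    (P := fun a => k ≤ a ∧ g (a * β) ∉ W) ⟨k, fun _ h => h.1⟩ (hW k).2
  have hak' : a < k := lt_of_le_of_ne hak (by rintro rfl; exact ha hk)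
  have hek' : k < e := lt_of_le_of_ne hek (by rintro rfl; exact he hk)
  let n : ℕ+ := ⟨(e - a).toNat, by lia⟩
  have hn : (((n : ℕ) : ℤ)) = e - a := Int.toNat_of_nonneg (by lia)
  let s : LegPath d β := LegPath.cut ⟨g, hg⟩ a n
  have hs : IsPiece g a s := LegPath.isPiece_cut ⟨g, hg⟩ a n
  have hl : (s.length : ℤ) = e - a := hn
  refine ⟨a, s, ⟨⟨by lia, ?_, ?_, fun j h1 h2 => ?_⟩, hs⟩, hak', by lia⟩
  · have := hs.apply le_rfl (by lia)
    rw [sub_self, Int.cast_zero, zero_mul] at this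
    rwa [this]
  · have := hs.apply (k := e) (by lia) (by lia)
    rw [← hl] at this
    have h3 : s.duration = ((s.length : ℤ) : ℝ) * β := by simp [LegPath.duration]
    rwa [h3, this]
  · have := hs.apply (k := a + j) (by lia) (by lia)
    rw [add_sub_cancel_left, Int.cast_natCast] at this
    rw [this]
    by_contra hj
    rcases le_total (a + j) k with h | h
    · have := hamax _ ⟨h, hj⟩
      lia
    · have := hemin _ ⟨h, hj⟩
      lia

/-- The parent is the `W'`-shred around the first interior particle of `s`. It cannot end before `s`
does, since its end would then be interior to `s` and so lie in `W ⊆ W'`. -/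
theorem Occurs.exists_parent {g : ℝ → Space d} (hg : Continuous g) (hWW' : W ⊆ W')
    (hW' : Exits β W' g) {a : ℤ} {s : LegPath d β} (hs : Occurs W g a s) :
    ∃ (b : ℤ) (t : LegPath d β), Occurs W' g b t ∧ b ≤ a ∧ a + s.length ≤ b + t.length ∧
      Occurs W t.eval (a - b) s := by
  have h2 := hs.two_le
  obtain ⟨b, t, ht, h3, h4⟩ := exists_occurs_of_mem hg hW'
    (hWW' (hs.mem (k := a + 1) (by lia) (by lia)))
  have h5 : a + s.length ≤ b + t.length := by
    by_contra! h
    exact ht.end_notMem (hWW' (hs.mem (by lia) h))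
  exact ⟨b, t, ht, by lia, h5, (ht.2.occurs_iff (by lia) h5).mpr hs⟩

/-! ### Exits -/

theorem LegPath.exits {t : LegPath d β} (h0 : t.eval 0 ∉ W) (h1 : t.eval t.duration ∉ W) :
    Exits β W t.eval := fun z => by
  refine ⟨⟨min z 0, min_le_left _ _, ?_⟩, ⟨max z t.length, le_max_left _ _, ?_⟩⟩
  · rwa [t.eval_of_nonpos (mul_nonpos_of_nonpos_of_nonneg _ hβ.out.le)]
    exact_mod_cast min_le_right z 0
  · rwa [t.eval_of_duration_le (mul_le_mul_of_nonneg_right _ hβ.out.le)]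
    exact_mod_cast le_max_right z t.length

theorem RootedLoop.exits {f : RootedLoop d β} (h : ¬ ∀ k : ℤ, f.periodic (k * β) ∈ W) :
    Exits β W f.periodic := fun z => by
  push Not at h
  obtain ⟨k, hk⟩ := h
  have hL : (1 : ℤ) ≤ f.1.length := by exact_mod_cast f.1.length_pos
  have key : ∀ j : ℤ, f.periodic ((k + j * f.1.length : ℤ) * β) ∉ W := fun j => by
    have := f.periodic_add_mul (k * β) j
    rw [← add_mul, ← Int.cast_add] at this
    rwa [this]
  -- Since the length is at least one, `|z - k|` periods carry the outside particle from `k` past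
  -- `z` in either direction.
  refine ⟨⟨k + (-|z - k|) * f.1.length, ?_, key _⟩, ⟨k + |z - k| * f.1.length, ?_, key _⟩⟩
  · nlinarith [abs_nonneg (z - k), neg_abs_le (z - k)]
  · nlinarith [abs_nonneg (z - k), le_abs_self (z - k)]

end BoseGas

namespace BoseGas

/-! ### Discrete measures -/

section Discrete

variable {X : Type*} [MeasurableSpace X]

/-- The measure is the sum of its atoms (of which there may be uncountably many). -/
def IsDiscrete (μ : Measure X) : Prop :=
  ∀ A, MeasurableSet A → μ A = ∑' x, A.indicator (fun x => μ {x}) x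

/-- Reduces every identity of shred measures to one between multiplicities of single paths. -/
theorem IsDiscrete.ext {μ ν : Measure X} (hμ : IsDiscrete μ) (hν : IsDiscrete ν)
    (h : ∀ x, μ {x} = ν {x}) : μ = ν :=
  Measure.ext fun A hA => by
    rw [hμ A hA, hν A hA]
    simp only [h]

theorem IsDiscrete.add {μ ν : Measure X} (hμ : IsDiscrete μ) (hν : IsDiscrete ν) :
    IsDiscrete (μ + ν) := fun A hA => by
  rw [Measure.add_apply, hμ A hA, hν A hA, ← ENNReal.tsum_add]
  refine tsum_congr fun x => ?_
  by_cases hx : x ∈ A <;> simp [hx]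

variable [MeasurableSingletonClass X]

theorem isDiscrete_pointMeasure (Γ : Set X) : IsDiscrete (pointMeasure Γ) := fun A hA => by
  rw [pointMeasure_apply _ hA, tsum_subtype Γ (A.indicator 1)]
  refine tsum_congr fun x => ?_
  simp only [pointMeasure_singleton, indicator]
  split_ifs <;> rfl

theorem IsDiscrete.sum {ι : Type*} {μ : ι → Measure X} (h : ∀ i, IsDiscrete (μ i)) :
    IsDiscrete (Measure.sum μ) := fun A hA => by
  rw [Measure.sum_apply _ hA]
  simp only [h _ A hA]
  rw [ENNReal.tsum_comm]
  refine tsum_congr fun x => ?_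
  by_cases hx : x ∈ A
  · simp [hx, Measure.sum_apply]
  · simp [hx]

theorem IsDiscrete.finsetSum {ι : Type*} {μ : ι → Measure X} (s : Finset ι)
    (h : ∀ i, IsDiscrete (μ i)) : IsDiscrete (∑ i ∈ s, μ i) := by
  rw [← Measure.sum_coe_finset]
  exact IsDiscrete.sum fun i => h i

end Discrete

/-! ### Multiplicities of shreds -/

variable {d : ℕ} {β : ℝ} [hβ : Fact (0 < β)] {W W' : Set (Space d)}

theorem shredAt_of_occurs {g : ℝ → Space d} {a : ℤ} {s : LegPath d β} (h : Occurs W g a s) :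
    shredAt W g a {s} = 1 := by
  rw [shredAt, pointMeasure_singleton]
  exact indicator_of_mem (s := {s | IsShred W s ∧ IsPiece g a s}) h 1

theorem shredAt_of_not_occurs {g : ℝ → Space d} {a : ℤ} {s : LegPath d β} (h : ¬ Occurs W g a s) :
    shredAt W g a {s} = 0 := by
  rw [shredAt, pointMeasure_singleton]
  exact indicator_of_notMem (s := {s | IsShred W s ∧ IsPiece g a s}) h 1

theorem isDiscrete_shredAt (g : ℝ → Space d) (a : ℤ) :
    IsDiscrete (shredAt W g a : Measure (LegPath d β)) := isDiscrete_pointMeasure _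

theorem isDiscrete_pathShreds (s : LegPath d β) : IsDiscrete (pathShreds W s) :=
  IsDiscrete.sum fun _ => isDiscrete_shredAt _ _

theorem Loop.isDiscrete_shreds (l : Loop d β) : IsDiscrete (l.shreds W) := by
  obtain ⟨f⟩ := l
  exact IsDiscrete.finsetSum _ fun _ => isDiscrete_shredAt _ _

theorem Interlacement.isDiscrete_shreds (g : Interlacement d β) : IsDiscrete (g.shreds W) := by
  obtain ⟨f⟩ := g
  exact IsDiscrete.sum fun _ => isDiscrete_shredAt _ _

theorem pathShreds_singleton (t s : LegPath d β) :
    pathShreds W t {s} = ∑' a : ℤ, shredAt W t.eval a {s} :=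
  Measure.sum_apply _ (measurableSet_singleton s)

theorem Interlacement.shreds_singleton (g : Trajectory d β) (s : LegPath d β) :
    Interlacement.shreds W (Quotient.mk _ g) {s} = ∑' a : ℤ, shredAt W g.1 a {s} :=
  Measure.sum_apply _ (measurableSet_singleton s)

theorem Loop.shreds_singleton (f : RootedLoop d β) (s : LegPath d β) :
    Loop.shreds W (Quotient.mk _ f) {s} =
      ∑ a ∈ Finset.range f.1.length, shredAt W f.periodic (a : ℤ) {s} := by
  change (∑ a ∈ Finset.range f.1.length, shredAt W f.periodic (a : ℤ)) {s} = _
  rw [Measure.finsetSum_apply]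

/-- Each `W`-shred of `g` is a `W`-shred of exactly one of the `W'`-shreds of `g`. -/
theorem shredAt_eq_tsum {g : ℝ → Space d} (hg : Continuous g) (hWW' : W ⊆ W')
    (hW' : Exits β W' g) (a : ℤ) (s : LegPath d β) :
    shredAt W g a {s} = ∑' (b : ℤ) (t : LegPath d β),
      shredAt W' g b {t} * shredAt W t.eval (a - b) {s} := by
  by_cases hs : Occurs W g a s
  · obtain ⟨b, t, ht, h1, h2, h3⟩ := hs.exists_parent hg hWW' hW'
    have hs2 := hs.two_le
    rw [shredAt_of_occurs hs, tsum_eq_single b, tsum_eq_single t]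
    · rw [shredAt_of_occurs ht, shredAt_of_occurs h3, one_mul]
    · intro t' ht'
      rw [shredAt_of_not_occurs fun h => ht' (h.eq_of_same_start ht), zero_mul]
    · intro b' hb'
      refine ENNReal.tsum_eq_zero.mpr fun t' => ?_
      by_contra h
      obtain ⟨h4, h5⟩ := mul_ne_zero_iff.mp h
      have ht' : Occurs W' g b' t' := by
        by_contra h
        exact h4 (shredAt_of_not_occurs h)
      have hs' : Occurs W t'.eval (a - b') s := by
        by_contra h
        exact h5 (shredAt_of_not_occurs h)
      obtain ⟨h6, h7, -⟩ := ht'.trans hWW' hs'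
      exact hb' (ht'.start_eq ht (k := a) (by lia) (by lia) (by lia) (by lia))
  · rw [shredAt_of_not_occurs hs]
    refine (ENNReal.tsum_eq_zero.mpr fun b => ENNReal.tsum_eq_zero.mpr fun t => ?_).symm
    by_cases ht : Occurs W' g b t
    · rw [shredAt_of_not_occurs (g := t.eval), mul_zero]
      intro h
      refine hs ?_
      simpa using (ht.trans hWW' h).2.2
    · rw [shredAt_of_not_occurs ht, zero_mul]

/-- Summing over parents first, the start of the child becomes the start of the parent plus a free
offset, and the double sum factorizes. -/
theorem tsum_shredAt {g : ℝ → Space d} (hg : Continuous g) (hWW' : W ⊆ W')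
    (hW' : Exits β W' g) (s : LegPath d β) :
    ∑' a : ℤ, shredAt W g a {s} = ∑' t : LegPath d β,
      (∑' b : ℤ, shredAt W' g b {t}) * pathShreds W t {s} := by
  simp only [shredAt_eq_tsum hg hWW' hW', pathShreds_singleton]
  rw [ENNReal.tsum_comm]
  simp only [← ENNReal.tsum_mul_right]
  rw [ENNReal.tsum_comm (α := LegPath d β)]
  refine tsum_congr fun b => ?_
  rw [ENNReal.tsum_comm]
  refine tsum_congr fun t => ?_
  rw [ENNReal.tsum_mul_left, ← (Equiv.subRight b).tsum_eq (fun a => shredAt W t.eval a {s})]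
  rfl

/-- A count of pairs of a parent start and a child offset up to a common shift by the period `L`: it
does not matter whether the child start or the parent start is restricted to one period. -/
theorem sum_range_tsum_sub (L : ℕ) [NeZero L] (K : ℤ → ℤ → ENNReal)
    (hK : ∀ a b, K (a + L) b = K a b) :
    ∑ a ∈ Finset.range L, ∑' b : ℤ, K b (a - b) = ∑ a ∈ Finset.range L, ∑' b : ℤ, K a b := by
  have hK' : ∀ (k a b : ℤ), K (a + k * L) b = K a b := by
    intro k a b
    induction k with
    | zero => simp
    | succ i ih => rw [add_mul, one_mul, ← add_assoc, hK, ih]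
    | pred i ih => rw [← ih, ← hK (a + (-i - 1) * L), add_assoc]; congr 2; ring
  have split : ∀ F : ℤ → ENNReal,
      ∑' b, F b = ∑' k : ℤ, ∑ r : Fin L, F ((r : ℕ) + k * L) := by
    intro F
    rw [← (Int.divModEquiv L).symm.tsum_eq]
    refine (ENNReal.tsum_prod
      (f := fun k r => F ((Int.divModEquiv L).symm (k, r)))).trans (tsum_congr fun k => ?_)
    rw [tsum_fintype]
    refine Finset.sum_congr rfl fun r _ => ?_
    congr 1
    simp only [Int.divModEquiv, Equiv.coe_fn_symm_mk]
    ring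
  simp only [Finset.sum_range]
  calc ∑ a : Fin L, ∑' b : ℤ, K b (a - b)
      = ∑ a : Fin L, ∑' k : ℤ, ∑ r : Fin L, K r ((a : ℕ) - ((r : ℕ) + k * L)) := by
        refine Finset.sum_congr rfl fun a _ => ?_
        rw [split]
        simp only [hK']
    _ = ∑ a : Fin L, ∑ r : Fin L, ∑' k : ℤ, K r ((a : ℕ) - ((r : ℕ) + k * L)) := by
        refine Finset.sum_congr rfl fun a _ => ?_
        exact Summable.tsum_finsetSum fun _ _ => ENNReal.summable
    _ = ∑ r : Fin L, ∑ a : Fin L, ∑' k : ℤ, K r ((a : ℕ) - ((r : ℕ) + k * L)) :=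
        Finset.sum_comm
    _ = ∑ r : Fin L, ∑' b : ℤ, K r b := by
        refine Finset.sum_congr rfl fun r _ => ?_
        rw [← (Equiv.subRight (r : ℤ)).tsum_eq, split,
          Summable.tsum_finsetSum fun _ _ => ENNReal.summable]
        refine Finset.sum_congr rfl fun a _ => ?_
        rw [← (Equiv.neg ℤ).tsum_eq]
        refine tsum_congr fun k => ?_
        congr 1
        simp
        ring

theorem Loop.shreds_of_allIn {l : Loop d β} (h : l.AllIn W) : l.shreds W = 0 := by
  obtain ⟨f⟩ := l
  have h' : ∀ k : ℤ, f.periodic (k * β) ∈ W := h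
  refine Finset.sum_eq_zero fun a _ => ?_
  refine IsDiscrete.ext (isDiscrete_shredAt _ _) (fun A _ => by simp) fun s => ?_
  rw [shredAt_of_not_occurs fun hs => hs.start_notMem (h' a)]
  rfl

theorem Loop.AllIn.mono {l : Loop d β} (h : l.AllIn W) (hW : W ⊆ W') : l.AllIn W' := by
  obtain ⟨f⟩ := l
  exact fun k => hW (h k)

theorem Loop.shreds_singleton_eq (l : Loop d β) (hWW' : W ⊆ W') (hl : ¬ l.AllIn W')
    (s : LegPath d β) :
    l.shreds W {s} = ∑' t, l.shreds W' {t} * pathShreds W t {s} := by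
  obtain ⟨f⟩ := l
  have hex : Exits β W' f.periodic := RootedLoop.exits hl
  have : NeZero f.1.length := ⟨f.1.length_pos.ne'⟩
  change Loop.shreds W (Quotient.mk _ f) {s} =
    ∑' t, Loop.shreds W' (Quotient.mk _ f) {t} * pathShreds W t {s}
  simp only [Loop.shreds_singleton, shredAt_eq_tsum f.continuous_periodic hWW' hex]
  rw [sum_range_tsum_sub f.1.length fun a b =>
    ∑' t : LegPath d β, shredAt W' f.periodic a {t} * shredAt W t.eval b {s}]
  · simp only [Finset.sum_mul]
    rw [Summable.tsum_finsetSum fun _ _ => ENNReal.summable]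
    refine Finset.sum_congr rfl fun a _ => ?_
    rw [ENNReal.tsum_comm]
    refine tsum_congr fun t => ?_
    rw [ENNReal.tsum_mul_left, pathShreds_singleton]
  · intro a b
    have := shredAt_shift W' f.periodic f.periodic (f.1.length : ℤ)
      (fun t => by exact_mod_cast (f.periodic_add t).symm) a
    simp only [this]

theorem pathShreds_singleton_eq {W'' : Set (Space d)} (hWW' : W ⊆ W') (hW'' : W' ⊆ W'')
    {u : LegPath d β} (hu : IsShred W'' u) (s : LegPath d β) :
    pathShreds W u {s} = ∑' t, pathShreds W' u {t} * pathShreds W t {s} := by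
  rw [pathShreds_singleton, tsum_shredAt u.continuous_eval hWW'
    (LegPath.exits (fun h => hu.eval_zero (hW'' h)) fun h => hu.eval_duration (hW'' h))]
  simp only [pathShreds_singleton u]

theorem Interlacement.shreds_singleton_eq (g : Interlacement d β) (hWW' : W ⊆ W')
    {K : Set (Space d)} (hK : IsCompact K) (hW' : W' ⊆ K) (s : LegPath d β) :
    g.shreds W {s} = ∑' t, g.shreds W' {t} * pathShreds W t {s} := by
  obtain ⟨g⟩ := g
  change Interlacement.shreds W (Quotient.mk _ g) {s} =
    ∑' t, Interlacement.shreds W' (Quotient.mk _ g) {t} * pathShreds W t {s}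
  simp only [Interlacement.shreds_singleton]
  exact tsum_shredAt g.1.continuous hWW' (Trajectory.exits hK hW' g) s

/-! ### Composition of projections -/

/-- If `b` is obtained by cutting the loops in `Λ` and the objects with the `W'`-shreds `o'` into
`W'`-shreds, then the loops and the `W`-shreds that are obtained directly agree with those of `b`. -/
theorem cut_eq_proj (hWW' : W ⊆ W') (Λ : Set (MarkedLoop d β)) {ι : Type*}
    (o o' : ι → Measure (LegPath d β)) (hod : ∀ i, IsDiscrete (o i))
    (ho : ∀ i s, o i {s} = ∑' t, o' i {t} * pathShreds W t {s}) (b : BoxConfig β W')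
    (h : (pointMeasure {p ∈ Λ | p.1.2.AllIn W'},
      (Measure.sum fun p : Λ => p.1.1.2.shreds W') + Measure.sum o') = b.toMeasures) :
    (pointMeasure {p ∈ Λ | p.1.2.AllIn W},
      (Measure.sum fun p : Λ => p.1.1.2.shreds W) + Measure.sum o) = b.proj W := by
  classical
  obtain ⟨h1, h2⟩ := Prod.ext_iff.mp h
  have hb : {p ∈ Λ | p.1.2.AllIn W'} = b.loops := pointMeasure_injective h1
  refine Prod.ext ?_ ?_
  · change pointMeasure _ = pointMeasure _
    congr 1
    ext p
    rw [← hb]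
    simp only [mem_ofPred_eq]
    exact ⟨fun hp => ⟨⟨hp.1, hp.2.mono hWW'⟩, hp.2⟩, fun hp => ⟨hp.1.1, hp.2⟩⟩
  · change _ + _ = (Measure.sum fun p : b.loops => p.1.1.2.shreds W) +
      Measure.sum fun s : b.shreds => pathShreds W (s : LegPath d β)
    refine IsDiscrete.ext (.add (.sum fun p => Loop.isDiscrete_shreds _) (.sum hod))
      (.add (.sum fun p => Loop.isDiscrete_shreds _) (.sum fun p => isDiscrete_pathShreds _))
      fun s => ?_
    -- Since `b` is simple, each `W'`-shred has total multiplicity one or zero.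
    have hmult : ∀ t, (∑' p : Λ, p.1.1.2.shreds W' {t}) + ∑' i, o' i {t} =
        b.shreds.indicator 1 t := fun t => by
      have := congrArg (fun μ : Measure (LegPath d β) => μ {t}) h2
      simpa only [Measure.add_apply, Measure.sum_apply _ (measurableSet_singleton t),
        BoxConfig.toMeasures, pointMeasure_singleton] using this
    simp only [Measure.add_apply, Measure.sum_apply _ (measurableSet_singleton s), ho]
    -- A loop inside `W'` survives as a loop and has no `W'`-shreds; any other loop enters `b` only
    -- through its `W'`-shreds. Exactly one of the two terms can contribute.
    have hloop : ∀ p : MarkedLoop d β, p.1.2.shreds W {s} =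
        (if p.1.2.AllIn W' then p.1.2.shreds W {s} else 0) +
          ∑' t, p.1.2.shreds W' {t} * pathShreds W t {s} := fun p => by
      by_cases hp : p.1.2.AllIn W'
      · simp [hp, Loop.shreds_of_allIn hp]
      · rw [Loop.shreds_singleton_eq p.1.2 hWW' hp s]
        simp [hp]
    have hin : ∑' p : Λ, (if p.1.1.2.AllIn W' then p.1.1.2.shreds W {s} else 0) =
        ∑' p : b.loops, p.1.1.2.shreds W {s} := by
      rw [tsum_subtype Λ fun p => if p.1.2.AllIn W' then p.1.2.shreds W {s} else 0,
        tsum_subtype b.loops fun p => p.1.2.shreds W {s}]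
      refine tsum_congr fun p => ?_
      rw [← hb]
      by_cases h1 : p ∈ Λ <;> by_cases h2 : p.1.2.AllIn W' <;> simp [h1, h2]
    have hsh : ∑' t : b.shreds, pathShreds W (t : LegPath d β) {s} =
        ∑' t, b.shreds.indicator 1 t * pathShreds W t {s} := by
      rw [tsum_subtype b.shreds fun t => pathShreds W t {s}]
      refine tsum_congr fun t => ?_
      by_cases h1 : t ∈ b.shreds <;> simp [h1]
    calc ∑' p : Λ, p.1.1.2.shreds W {s} + ∑' i, ∑' t, o' i {t} * pathShreds W t {s}
        = (∑' p : b.loops, p.1.1.2.shreds W {s}) +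
            ((∑' p : Λ, ∑' t, p.1.1.2.shreds W' {t} * pathShreds W t {s}) +
              ∑' i, ∑' t, o' i {t} * pathShreds W t {s}) := by
          rw [← hin, ← add_assoc, ← ENNReal.tsum_add]
          congr 1
          exact tsum_congr fun p => hloop p
      _ = _ := by
          congr 1
          rw [hsh, ENNReal.tsum_comm, ENNReal.tsum_comm (α := ι), ← ENNReal.tsum_add]
          refine tsum_congr fun t => ?_
          rw [ENNReal.tsum_mul_right, ENNReal.tsum_mul_right, ← add_mul, hmult]

theorem Config.proj_eq_proj (hWW' : W ⊆ W') {K : Set (Space d)} (hK : IsCompact K) (hW' : W' ⊆ K)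
    (c : Config d β) (b : BoxConfig β W') (h : c.proj W' = b.toMeasures) :
    c.proj W = b.proj W :=
  cut_eq_proj hWW' c.loops (fun g : c.interlacements => g.1.shreds W)
    (fun g : c.interlacements => g.1.shreds W') (fun g => g.1.isDiscrete_shreds)
    (fun g s => g.1.shreds_singleton_eq hWW' hK hW' s) b h

theorem BoxConfig.proj_eq_proj {W'' : Set (Space d)} (hWW' : W ⊆ W') (hW'' : W' ⊆ W'')
    (c : BoxConfig β W'') (b : BoxConfig β W') (h : c.proj W' = b.toMeasures) :
    c.proj W = b.proj W :=
  cut_eq_proj hWW' c.loops (fun s : c.shreds => pathShreds W (s : LegPath d β))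
    (fun s : c.shreds => pathShreds W' (s : LegPath d β)) (fun _ => isDiscrete_pathShreds _)
    (fun u s => pathShreds_singleton_eq hWW' hW'' (c.isShred u u.2) s) b h

end BoseGas

namespace BoseGas

/-! ### Consistent sequences of configurations -/

theorem eq_of_tsum_le_one {ι : Type*} {f : ι → ENNReal} (hf : ∑' i, f i ≤ 1) {i j : ι}
    (hi : 1 ≤ f i) (hj : 1 ≤ f j) : i = j := by
  classical
  by_contra hij
  have h := (ENNReal.sum_le_tsum (f := f) {i, j}).trans hf
  rw [Finset.sum_pair hij] at h
  have h2 : (1 : ENNReal) + 1 ≤ 1 := (add_le_add hi hj).trans h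
  norm_num at h2

variable {d : ℕ} {β : ℝ} [hβ : Fact (0 < β)]

theorem pathShreds_ne_zero_iff {W : Set (Space d)} {t s : LegPath d β} :
    pathShreds W t {s} ≠ 0 ↔ ∃ a, Occurs W t.eval a s := by
  rw [pathShreds_singleton, Ne, ENNReal.tsum_eq_zero, not_forall]
  refine exists_congr fun a => ⟨fun h => ?_, fun h => ?_⟩
  · by_contra h'
    exact h (shredAt_of_not_occurs h')
  · rw [shredAt_of_occurs h]
    exact one_ne_zero

theorem Interlacement.shreds_ne_zero_iff {W : Set (Space d)} {g : Trajectory d β}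
    {s : LegPath d β} :
    Interlacement.shreds W (Quotient.mk _ g) {s} ≠ 0 ↔ ∃ a, Occurs W g.1 a s := by
  rw [Interlacement.shreds_singleton, Ne, ENNReal.tsum_eq_zero, not_forall]
  refine exists_congr fun a => ⟨fun h => ?_, fun h => ?_⟩
  · by_contra h'
    exact h (shredAt_of_not_occurs h')
  · rw [shredAt_of_occurs h]
    exact one_ne_zero

theorem Loop.one_le_shreds_of_occurs {W : Set (Space d)} {f : RootedLoop d β} {s : LegPath d β}
    {a : ℤ} (h : Occurs W f.periodic a s) : 1 ≤ Loop.shreds W (Quotient.mk _ f) {s} := by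
  have hL : (0 : ℤ) < f.1.length := by exact_mod_cast f.1.length_pos
  have hmod : (0 : ℤ) ≤ a % f.1.length := Int.emod_nonneg _ hL.ne'
  have hlt := Int.emod_lt_of_pos a hL
  have hocc : Occurs W f.periodic ((a % f.1.length).toNat : ℤ) s := by
    refine (Occurs.congr_piece fun t _ => ?_).mp h
    rw [Int.toNat_of_nonneg hmod, ←
      f.periodic_add_mul ((a % f.1.length : ℤ) * β + t) (a / f.1.length)]
    congr 1
    have := congrArg (fun z : ℤ => (z : ℝ)) (Int.emod_add_ediv_mul a f.1.length)
    push_cast at this ⊢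
    linear_combination (-β) * this
  rw [Loop.shreds_singleton, ← shredAt_of_occurs hocc]
  exact Finset.single_le_sum (f := fun a : ℕ => shredAt W f.periodic (a : ℤ) {s})
    (fun _ _ => zero_le) (Finset.mem_range.mpr (by lia))

theorem Loop.one_le_shreds_of_ne_zero {W : Set (Space d)} {l : Loop d β} {s : LegPath d β}
    (h : l.shreds W {s} ≠ 0) : 1 ≤ l.shreds W {s} := by
  obtain ⟨f⟩ := l
  change Loop.shreds W (Quotient.mk _ f) {s} ≠ 0 at h
  rw [Loop.shreds_singleton] at h
  obtain ⟨a, -, ha⟩ := Finset.exists_ne_zero_of_sum_ne_zero h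
  by_cases hs : Occurs W f.periodic a s
  · exact Loop.one_le_shreds_of_occurs hs
  · exact absurd (shredAt_of_not_occurs hs) ha

/-- The root is a particle in `W` and the loop leaves `W`, so a shred surrounds the root. This will
bound the number of loops that start in a window. -/
theorem MarkedLoop.exists_one_le_shreds {W : Set (Space d)} {p : MarkedLoop d β}
    (hp : p.1.1 ∈ W) (hW : ¬ p.1.2.AllIn W) : ∃ s, 1 ≤ p.1.2.shreds W {s} := by
  obtain ⟨⟨x, l⟩, f, hfl, hfx⟩ := p
  dsimp only at hfl hfx hp hW
  subst hfl hfx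
  obtain ⟨a, s, hs, -⟩ := exists_occurs_of_mem f.continuous_periodic
    (RootedLoop.exits (W := W) hW) (k := 0) (by simpa using hp)
  exact ⟨s, Loop.one_le_shreds_of_occurs hs⟩

section Consistent

variable {W : ℕ → Set (Space d)} (b : ∀ n, BoxConfig β (W n))

/-- The configurations in the windows `W 0 ⊆ W 1 ⊆ ⋯` are mapped to each other by the
projections. -/
def Consistent : Prop := ∀ n, (b (n + 1)).proj (W n) = (b n).toMeasures

variable {b}

namespace Consistent

theorem proj_eq (hW : Monotone W) (hb : Consistent b)
    {n N : ℕ} (h : n < N) : (b N).proj (W n) = (b n).toMeasures := by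
  induction N, h using Nat.le_induction with
  | base => exact hb n
  | succ N hN ih =>
    rw [BoxConfig.proj_eq_proj (hW (Nat.le_of_succ_le hN)) (hW N.le_succ) _ _ (hb N), ih]

theorem loops_eq (hW : Monotone W) (hb : Consistent b) {n N : ℕ} (h : n < N) :
    {p ∈ (b N).loops | p.1.2.AllIn (W n)} = (b n).loops :=
  pointMeasure_injective (Prod.ext_iff.mp (proj_eq hW hb h)).1

theorem loops_mono (hW : Monotone W) (hb : Consistent b) : Monotone fun n => (b n).loops :=
  monotone_nat_of_le_succ fun n _ hp => by
    rw [← loops_eq hW hb n.lt_succ_self] at hp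
    exact hp.1

/-- The bookkeeping identity behind all that follows: a given shred arises exactly once from the
larger window, by one loop or by one shred, and no other path arises. -/
theorem mult_eq (hW : Monotone W) (hb : Consistent b) {n N : ℕ} (h : n < N) (s : LegPath d β) :
    ∑' p : (b N).loops, p.1.1.2.shreds (W n) {s} +
      ∑' t : (b N).shreds, pathShreds (W n) (t : LegPath d β) {s} =
      (b n).shreds.indicator 1 s := by
  have := congrArg (fun μ : Measure (LegPath d β) => μ {s})
    (Prod.ext_iff.mp (proj_eq hW hb h)).2
  simpa only [BoxConfig.proj, BoxConfig.toMeasures, Measure.add_apply,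
    Measure.sum_apply _ (measurableSet_singleton s), pointMeasure_singleton] using this

theorem mult_le_one (hW : Monotone W) (hb : Consistent b) {n N : ℕ} (h : n < N) (s : LegPath d β) :
    ∑' p : (b N).loops, p.1.1.2.shreds (W n) {s} +
      ∑' t : (b N).shreds, pathShreds (W n) (t : LegPath d β) {s} ≤ 1 := by
  rw [mult_eq hW hb h]
  exact indicator_apply_le' (fun _ => le_rfl) fun _ => zero_le

theorem loopShreds_eq_zero (hW : Monotone W) (hb : Consistent b)
    {n N : ℕ} (h : n < N) {s : LegPath d β} (hs : s ∉ (b n).shreds)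
    {p : MarkedLoop d β} (hp : p ∈ (b N).loops) : p.1.2.shreds (W n) {s} = 0 := by
  have := mult_eq hW hb h s
  rw [indicator_of_notMem hs, add_eq_zero] at this
  exact ENNReal.tsum_eq_zero.mp this.1 ⟨p, hp⟩

theorem mem_of_occurs (hW : Monotone W) (hb : Consistent b)
    {n N : ℕ} (h : n < N) {t s : LegPath d β} (ht : t ∈ (b N).shreds) {a : ℤ}
    (hs : Occurs (W n) t.eval a s) : s ∈ (b n).shreds := by
  by_contra hn
  have := mult_eq hW hb h s
  rw [indicator_of_notMem hn, add_eq_zero] at this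
  exact pathShreds_ne_zero_iff.mpr ⟨a, hs⟩ (ENNReal.tsum_eq_zero.mp this.2 ⟨t, ht⟩)

theorem occurs_unique (hW : Monotone W) (hb : Consistent b)
    {n N : ℕ} (h : n < N) {t t' s : LegPath d β} (ht : t ∈ (b N).shreds)
    (ht' : t' ∈ (b N).shreds) {a a' : ℤ} (hs : Occurs (W n) t.eval a s)
    (hs' : Occurs (W n) t'.eval a' s) : t = t' ∧ a = a' := by
  have hle := le_add_self.trans (mult_le_one hW hb h s)
  simp only [pathShreds_singleton] at hle
  -- Summing over pairs of shred and offset makes the bound by one exclude both a second shred and a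
  -- second offset.
  rw [← ENNReal.tsum_prod (f := fun (t : (b N).shreds) a =>
    shredAt (W n) (t : LegPath d β).eval a {s})] at hle
  have := eq_of_tsum_le_one hle (i := (⟨t, ht⟩, a)) (j := (⟨t', ht'⟩, a'))
    (shredAt_of_occurs hs).ge (shredAt_of_occurs hs').ge
  simpa using this

theorem loop_unique (hW : Monotone W) (hb : Consistent b)
    {n N : ℕ} (h : n < N) {s : LegPath d β} {p p' : MarkedLoop d β}
    (hp : p ∈ (b N).loops) (hp' : p' ∈ (b N).loops) (hs : p.1.2.shreds (W n) {s} ≠ 0)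
    (hs' : p'.1.2.shreds (W n) {s} ≠ 0) : p = p' := by
  have hle := le_self_add.trans (mult_le_one hW hb h s)
  have := eq_of_tsum_le_one hle (i := ⟨p, hp⟩) (j := ⟨p', hp'⟩)
    (Loop.one_le_shreds_of_ne_zero hs) (Loop.one_le_shreds_of_ne_zero hs')
  simpa using this

theorem loopShreds_eq_one (hW : Monotone W) (hb : Consistent b)
    {n N : ℕ} (h : n < N) {s : LegPath d β} {p : MarkedLoop d β}
    (hp : p ∈ (b N).loops) (hs : p.1.2.shreds (W n) {s} ≠ 0) :
    p.1.2.shreds (W n) {s} = 1 :=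
  le_antisymm ((ENNReal.le_tsum (f := fun p : (b N).loops => p.1.1.2.shreds (W n) {s})
    ⟨p, hp⟩).trans (le_self_add.trans (mult_le_one hW hb h s)))
    (Loop.one_le_shreds_of_ne_zero hs)

theorem not_loop_of_occurs (hW : Monotone W) (hb : Consistent b)
    {n N : ℕ} (h : n < N) {t s : LegPath d β} (ht : t ∈ (b N).shreds)
    {a : ℤ} (hs : Occurs (W n) t.eval a s) {p : MarkedLoop d β} (hp : p ∈ (b N).loops) :
    p.1.2.shreds (W n) {s} = 0 := by
  by_contra hps
  have h1 : 1 ≤ ∑' p : (b N).loops, p.1.1.2.shreds (W n) {s} :=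
    (Loop.one_le_shreds_of_ne_zero hps).trans
      (ENNReal.le_tsum (f := fun p : (b N).loops => p.1.1.2.shreds (W n) {s}) ⟨p, hp⟩)
  have h2 : 1 ≤ ∑' t : (b N).shreds, pathShreds (W n) (t : LegPath d β) {s} := by
    refine le_trans ?_ (ENNReal.le_tsum (f := fun t : (b N).shreds =>
      pathShreds (W n) (t : LegPath d β) {s}) ⟨t, ht⟩)
    dsimp only
    rw [pathShreds_singleton, ← shredAt_of_occurs hs]
    exact ENNReal.le_tsum (f := fun a : ℤ => shredAt (W n) t.eval a {s}) a
  have := (add_le_add h1 h2).trans (mult_le_one hW hb h s)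
  norm_num at this

theorem exists_occurs_of_no_loop (hW : Monotone W) (hb : Consistent b)
    {n N : ℕ} (h : n < N) {s : LegPath d β} (hs : s ∈ (b n).shreds)
    (hp : ∀ p ∈ (b N).loops, p.1.2.shreds (W n) {s} = 0) :
    ∃ t ∈ (b N).shreds, ∃ a, Occurs (W n) t.eval a s := by
  have := mult_eq hW hb h s
  rw [ENNReal.tsum_eq_zero.mpr fun p : (b N).loops => hp p p.2, zero_add,
    indicator_of_mem hs] at this
  have hne : ∑' t : (b N).shreds, pathShreds (W n) (t : LegPath d β) {s} ≠ 0 := by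
    rw [this]
    exact one_ne_zero
  rw [Ne, ENNReal.tsum_eq_zero, not_forall] at hne
  obtain ⟨t, ht⟩ := hne
  exact ⟨t, t.2, pathShreds_ne_zero_iff.mp ht⟩

end Consistent

end Consistent

/-! ### Functions all of whose shreds are given -/

theorem IsPiece.eval_sub {g : ℝ → Space d} {a : ℤ} {s : LegPath d β} (h : IsPiece g a s) {x : ℝ}
    (h1 : a * β ≤ x) (h2 : x ≤ (a + s.length : ℤ) * β) : g x = s.eval (x - a * β) := by
  rw [h]
  · congr 1
    ring
  · refine ⟨by linarith, ?_⟩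
    push_cast at h2
    change x - a * β ≤ s.length * β
    linarith

section Fits

variable {W : ℕ → Set (Space d)} {b : ∀ n, BoxConfig β (W n)}

/-- All the shreds of `g` belong to the given configurations. -/
structure Fits (b : ∀ n, BoxConfig β (W n)) (g : ℝ → Space d) : Prop where
  continuous : Continuous g
  exits : ∀ n, Exits β (W n) g
  mem : ∀ n a s, Occurs (W n) g a s → s ∈ (b n).shreds

/-- Finitely many particles are bounded, so large windows contain them all, and the shred around the
first cannot end before the last. -/
theorem Fits.exists_window (hW : Monotone W)
    (hcov : ∀ A : Set (Space d), Bornology.IsBounded A → ∃ n, A ⊆ W n)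
    {g : ℝ → Space d} (hg : Fits b g) {k l : ℤ} (hkl : k ≤ l) :
    ∃ N₀, ∀ N ≥ N₀, ∃ (a : ℤ) (t : LegPath d β), Occurs (W N) g a t ∧ t ∈ (b N).shreds ∧
      a < k ∧ l < a + t.length := by
  obtain ⟨N₀, hN₀⟩ := hcov ((fun i : ℤ => g (i * β)) '' Icc k l)
    ((finite_Icc k l).image _).isBounded
  refine ⟨N₀, fun N hN => ?_⟩
  have hmem : ∀ i : ℤ, k ≤ i → i ≤ l → g (i * β) ∈ W N := fun i h1 h2 =>
    hW hN (hN₀ ⟨i, ⟨h1, h2⟩, rfl⟩)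
  obtain ⟨a, t, ht, h1, h2⟩ := exists_occurs_of_mem hg.continuous (hg.exits N)
    (hmem k le_rfl hkl)
  refine ⟨a, t, ht, hg.mem N a t ht, h1, ?_⟩
  by_contra! h
  exact ht.end_notMem (hmem _ h2.le h)

/-- Both occurrences lie in one given shred of a larger window, in which `s` has a single offset. -/
theorem Fits.occurs_unique (hW : Monotone W)
    (hcov : ∀ A : Set (Space d), Bornology.IsBounded A → ∃ n, A ⊆ W n)
    (hb : Consistent b) {g : ℝ → Space d} (hg : Fits b g) {n : ℕ}
    {a a' : ℤ} {s : LegPath d β} (h : Occurs (W n) g a s) (h' : Occurs (W n) g a' s) : a = a' := by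
  have h2 := h.two_le
  obtain ⟨N₀, hN₀⟩ := hg.exists_window hW hcov
    (k := min a a') (l := max (a + s.length) (a' + s.length)) (by lia)
  obtain ⟨A, t, ht, htb, h3, h4⟩ := hN₀ (max N₀ (n + 1)) (le_max_left _ _)
  have h5 := (ht.2.occurs_iff (s := s) (b := a) (W := W n) (by lia) (by lia)).mpr h
  have h6 := (ht.2.occurs_iff (s := s) (b := a') (W := W n) (by lia) (by lia)).mpr h'
  have := (hb.occurs_unique hW (lt_of_lt_of_le n.lt_succ_self (le_max_right _ _)) htb htb
    h5 h6).2
  lia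

/-- In a large window, both functions have a given shred that contains `s` and the time in question.
As both contain `s`, these are the same shred with the same offset. -/
theorem Fits.eq_of_occurs (hW : Monotone W)
    (hcov : ∀ A : Set (Space d), Bornology.IsBounded A → ∃ n, A ⊆ W n)
    (hb : Consistent b) {g g' : ℝ → Space d} (hg : Fits b g)
    (hg' : Fits b g') {n : ℕ} {a a' : ℤ} {s : LegPath d β} (h : Occurs (W n) g a s)
    (h' : Occurs (W n) g' a' s) (x : ℝ) : g (x + a * β) = g' (x + a' * β) := by
  have h2 := h.two_le
  set k := ⌊x / β⌋
  have hk1 : k * β ≤ x := by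
    rw [← le_div_iff₀ hβ.out]
    exact Int.floor_le _
  have hk2 : x ≤ (k + 1 : ℤ) * β := by
    rw [← div_le_iff₀ hβ.out]
    push_cast
    exact (Int.lt_floor_add_one _).le
  obtain ⟨N₁, hN₁⟩ := hg.exists_window hW hcov
    (k := min a (k + a)) (l := max (a + s.length) (k + 1 + a)) (by lia)
  obtain ⟨N₂, hN₂⟩ := hg'.exists_window hW hcov
    (k := min a' (k + a')) (l := max (a' + s.length) (k + 1 + a')) (by lia)
  obtain ⟨N, h1N, h2N, hnN⟩ : ∃ N, N₁ ≤ N ∧ N₂ ≤ N ∧ n < N :=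
    ⟨max (max N₁ N₂) (n + 1), by lia, by lia, by lia⟩
  obtain ⟨A, t, ht, htb, h3, h4⟩ := hN₁ N h1N
  obtain ⟨A', t', ht', htb', h3', h4'⟩ := hN₂ N h2N
  have h5 := (ht.2.occurs_iff (s := s) (b := a) (W := W n) (by lia) (by lia)).mpr h
  have h6 := (ht'.2.occurs_iff (s := s) (b := a') (W := W n) (by lia) (by lia)).mpr h'
  obtain ⟨rfl, h7⟩ := hb.occurs_unique hW hnN htb htb' h5 h6
  have key : ∀ {g : ℝ → Space d} {a A : ℤ}, IsPiece g A t → A < k + a → k + 1 + a < A + t.length →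
      g (x + a * β) = t.eval (x + (a - A : ℤ) * β) := by
    intro g a A hp h1 h2
    have h1' : (A : ℝ) ≤ k + a := by exact_mod_cast h1.le
    have h2' : (k : ℝ) + 1 + a ≤ A + t.length := by exact_mod_cast h2.le
    have h1'' := mul_le_mul_of_nonneg_right h1' hβ.out.le
    have h2'' := mul_le_mul_of_nonneg_right h2' hβ.out.le
    push_cast at hk2
    rw [hp.eval_sub]
    · congr 1
      push_cast
      ring
    · linarith
    · push_cast
      linarith
  rw [key ht.2 (by lia) (by lia), key ht'.2 (by lia) (by lia), h7]

end Fits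

end BoseGas

namespace BoseGas

/-! ### Gluing shreds to interlacements -/

section Glue

variable {d : ℕ} {β : ℝ} [hβ : Fact (0 < β)] {W : ℕ → Set (Space d)}
  {b : ∀ n, BoxConfig β (W n)}

theorem Trajectory.fits (hcpt : ∀ n, IsCompact (W n)) {g : Trajectory d β}
    (hg : ∀ n s, Interlacement.shreds (W n) (Quotient.mk _ g) {s} ≠ 0 → s ∈ (b n).shreds) :
    Fits b g.1 :=
  ⟨g.1.continuous, fun n => Trajectory.exits (hcpt n) subset_rfl g,
    fun n a s hs => hg n s (Interlacement.shreds_ne_zero_iff.mpr ⟨a, hs⟩)⟩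

/-- A shred that is not part of a loop in any larger window is part of an interlacement. -/
theorem exists_fits (hW : Monotone W)
    (hcov : ∀ A : Set (Space d), Bornology.IsBounded A → ∃ n, A ⊆ W n)
    (hb : Consistent b) {n : ℕ} {s : LegPath d β} (hs : s ∈ (b n).shreds)
    (hp : ∀ N, n < N → ∀ p ∈ (b N).loops, p.1.2.shreds (W n) {s} = 0) :
    ∃ g : ℝ → Space d, Fits b g ∧ Occurs (W n) g 0 s := by
  have hlt : ∀ k, n < n + 1 + k := fun k => by lia
  -- At level `n + 1 + k`, the shred `t k` contains `s` at offset `o k`; time zero of the limit is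
  -- the start of `s`.
  choose t ht o ho using fun k : ℕ =>
    hb.exists_occurs_of_no_loop hW (hlt k) hs (hp _ (hlt k))
  have hsh : ∀ k, IsShred (W (n + 1 + k)) (t k) := fun k => (b _).isShred _ (ht k)
  have hsub : ∀ {k m}, k ≤ m → W (n + 1 + k) ⊆ W (n + 1 + m) := fun h => hW (by lia)
  -- The parent of `s` inside `t m` at level `n + 1 + k` is a given shred containing `s`, hence it
  -- is `t k`, and the offsets match.
  have piece : ∀ k m, k < m → Occurs (W (n + 1 + k)) (t m).eval (o m - o k) (t k) ∧
      0 ≤ o m - o k ∧ o m - o k + (t k).length ≤ (t m).length := by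
    intro k m hkm
    have h0 : (t m).eval 0 ∉ W (n + 1 + k) := fun h => (hsh m).eval_zero (hsub hkm.le h)
    have h1 : (t m).eval (t m).duration ∉ W (n + 1 + k) := fun h =>
      (hsh m).eval_duration (hsub hkm.le h)
    obtain ⟨A, u, hu, -, -, h4⟩ := (ho m).exists_parent (t m).continuous_eval
      (hW (hlt k).le) (LegPath.exits h0 h1)
    have hub := hb.mem_of_occurs hW (by lia) (ht m) hu
    obtain ⟨rfl, h5⟩ := hb.occurs_unique hW (hlt k) (ht k) hub (ho k) h4
    obtain rfl : A = o m - o k := by lia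
    exact ⟨hu, hu.window h0 h1⟩
  -- Once the window contains both endpoints of `t k`, these are no longer outside, so `t m` extends
  -- strictly beyond `t k` at both ends.
  have grow : ∀ k, ∃ m > k, o k < o m ∧ (t k).length - o k < (t m).length - o m := by
    intro k
    obtain ⟨N, hN⟩ := hcov {(t k).eval 0, (t k).eval (t k).duration} (toFinite _).isBounded
    obtain ⟨m, hkm, hNm⟩ : ∃ m, k < m ∧ N ≤ m := ⟨max (k + 1) N, by lia, by lia⟩
    have hNm' : W N ⊆ W (n + 1 + m) := hW (by lia)
    obtain ⟨h1, h2, h3⟩ := piece k m hkm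
    refine ⟨m, hkm, ?_, ?_⟩
    · by_contra! h
      refine (hsh m).eval_zero (hNm' (hN (.inl ?_)))
      have := h1.2.apply le_rfl (by lia)
      have hz : o m - o k = 0 := by lia
      simpa [hz] using this.symm
    · by_contra! h
      refine (hsh m).eval_duration (hNm' (hN (.inr ?_)))
      have := h1.2.apply (k := (t m).length) (by lia) (by lia)
      have hz : ((t m).length : ℤ) - (o m - o k) = (t k).length := by lia
      rw [hz] at this
      simpa [LegPath.duration] using this.symm
  have wide : ∀ K : ℕ, ∃ k, K ≤ k ∧ (K : ℤ) ≤ o k ∧ (K : ℤ) ≤ (t k).length - o k := by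
    intro K
    induction K with
    | zero =>
      have h2 := (ho 0).two_le
      obtain ⟨h3, h4⟩ := (ho 0).window (fun h => (hsh 0).eval_zero (hW (hlt 0).le h))
        (fun h => (hsh 0).eval_duration (hW (hlt 0).le h))
      exact ⟨0, le_rfl, by simpa using h3, by push_cast; lia⟩
    | succ K ih =>
      obtain ⟨k, h1, h2, h3⟩ := ih
      obtain ⟨m, h4, h5, h6⟩ := grow k
      exact ⟨m, by lia, by push_cast; lia, by push_cast; lia⟩
  choose κ hκ hκo hκl using wide
  let h : ℕ → ℝ → Space d := fun k x => (t k).eval (x + o k * β)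
  let I : ℕ → Set ℝ := fun k => Icc ((-o k : ℤ) * β) ((-o k + (t k).length : ℤ) * β)
  have compat : ∀ {k m}, k ≤ m → ∀ x ∈ I k, h m x = h k x := by
    intro k m hkm x hx
    rcases hkm.eq_or_lt with rfl | hkm
    · rfl
    · have h1 := hx.1
      have h2 := hx.2
      push_cast at h1 h2
      simp only [h]
      rw [(piece k m hkm).1.2.eval_sub]
      · congr 1
        push_cast
        ring
      · push_cast
        linarith
      · push_cast
        linarith
  have mem_I : ∀ (K : ℕ) (x : ℝ), |x| ≤ K * β → x ∈ I (κ K) := by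
    intro K x hx
    obtain ⟨h1, h2⟩ := abs_le.mp hx
    have h3 : (K : ℝ) ≤ o (κ K) := by exact_mod_cast hκo K
    have h4 : (K : ℝ) ≤ (t (κ K)).length - o (κ K) := by exact_mod_cast hκl K
    have h3' := mul_le_mul_of_nonneg_right h3 hβ.out.le
    have h4' := mul_le_mul_of_nonneg_right h4 hβ.out.le
    constructor <;> push_cast <;> linarith
  have abs_le_ceil : ∀ x : ℝ, x ≤ ⌈x / β⌉₊ * β := fun x => by
    rw [← div_le_iff₀ hβ.out]
    exact Nat.le_ceil _
  -- The pieces agree on overlaps, so any index whose interval contains `x` gives the same value;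
  -- `κ` supplies one.
  let g : ℝ → Space d := fun x => h (κ ⌈|x| / β⌉₊) x
  have g_eq : ∀ k, ∀ x ∈ I k, g x = h k x := fun k x hx =>
    (compat (le_max_left _ k) x (mem_I _ x (abs_le_ceil _))).symm.trans
      (compat (le_max_right _ k) x hx)
  have gocc : ∀ k, Occurs (W (n + 1 + k)) g (-o k) (t k) := fun k => by
    refine ⟨hsh k, fun x hx => ?_⟩
    have hx2 : x ≤ (t k).length * β := hx.2
    rw [g_eq k]
    · simp only [h]
      congr 1
      push_cast
      ring
    · refine ⟨by linarith [hx.1], ?_⟩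
      push_cast
      linarith
  refine ⟨g, ⟨?_, ?_, ?_⟩, ?_⟩
  · refine continuous_iff_continuousAt.mpr fun x => ?_
    have hc : ContinuousAt (h (κ ⌈(|x| + 1) / β⌉₊)) x :=
      ((t _).continuous_eval.comp (continuous_add_const _)).continuousAt
    refine hc.congr ?_
    filter_upwards [Metric.ball_mem_nhds x one_pos] with y hy
    refine (g_eq _ y (mem_I _ y ((le_trans ?_ (abs_le_ceil _))))).symm
    have h1 : |y - x| < 1 := hy
    have h2 := abs_sub_abs_le_abs_sub y x
    linarith
  -- The index is taken so large that the shred `t k` extends past `z` on both sides and its window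
  -- contains `W m`; its endpoints are then outside of `W m`.
  · intro m z
    have h1 := hκ (z.natAbs + m)
    have h2 := hκo (z.natAbs + m)
    have h3 := hκl (z.natAbs + m)
    set k := κ (z.natAbs + m)
    have hsub' : W m ⊆ W (n + 1 + k) := hW (by lia)
    exact ⟨⟨-o k, by lia, fun h => (gocc k).start_notMem (hsub' h)⟩,
      ⟨-o k + (t k).length, by lia, fun h => (gocc k).end_notMem (hsub' h)⟩⟩
  · intro m a u hu
    have h1 := hκ (a.natAbs + u.length + m)
    have h2 := hκo (a.natAbs + u.length + m)
    have h3 := hκl (a.natAbs + u.length + m)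
    set k := κ (a.natAbs + u.length + m)
    exact hb.mem_of_occurs hW (by lia : m < n + 1 + k) (ht k)
      (((gocc k).2.occurs_iff (by lia) (by lia)).mpr hu)
  · have := ((gocc 0).trans (hW (hlt 0).le) (ho 0)).2.2
    simpa using this

/-- Each particle in the compact set is interior to one of finitely many given shreds, and each of
these occurs at most once along `g`. -/
theorem Fits.finite_particles (hW : Monotone W)
    (hcov : ∀ A : Set (Space d), Bornology.IsBounded A → ∃ n, A ⊆ W n)
    (hb : Consistent b) {g : ℝ → Space d} (hg : Fits b g) {K : Set (Space d)}
    (hK : IsCompact K) : {k : ℤ | g (k * β) ∈ K}.Finite := by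
  obtain ⟨m, hm⟩ := hcov K hK.isBounded
  have hfin : (⋃ u ∈ (b m).shreds,
      {k : ℤ | ∃ a, Occurs (W m) g a u ∧ a < k ∧ k < a + u.length}).Finite := by
    refine (b m).finite_shreds.biUnion fun u _ => ?_
    by_cases h : ∃ a, Occurs (W m) g a u
    · obtain ⟨a, ha⟩ := h
      refine (finite_Ioo a (a + u.length)).subset ?_
      rintro k ⟨a', ha', h1, h2⟩
      obtain rfl := hg.occurs_unique hW hcov hb ha ha'
      exact ⟨h1, h2⟩
    · refine finite_empty.subset ?_
      rintro k ⟨a, ha, -⟩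
      exact (h ⟨a, ha⟩).elim
  refine hfin.subset fun k hk => ?_
  obtain ⟨a, u, hu, h1, h2⟩ := exists_occurs_of_mem hg.continuous (hg.exits m) (hm hk)
  exact mem_iUnion₂.mpr ⟨u, hg.mem m a u hu, a, hu, h1, h2⟩

end Glue

end BoseGas

namespace BoseGas

/-! ### The configuration that belongs to a consistent sequence -/

section Limit

variable {d : ℕ} {β : ℝ} [hβ : Fact (0 < β)] {W : ℕ → Set (Space d)}
  {b : ∀ n, BoxConfig β (W n)}

/-- The loops of a sequence of configurations. -/
def limitLoops (b : ∀ n, BoxConfig β (W n)) : Set (MarkedLoop d β) := ⋃ n, (b n).loops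

/-- The interlacements all of whose shreds belong to the given configurations. -/
def limitInterlacements (b : ∀ n, BoxConfig β (W n)) : Set (Interlacement d β) :=
  {γ | ∀ n s, γ.shreds (W n) {s} ≠ 0 → s ∈ (b n).shreds}

theorem exists_lt_mem_loops (hW : Monotone W) (hb : Consistent b)
    {p : MarkedLoop d β} (hp : p ∈ limitLoops b) (n : ℕ) :
    ∃ N₀, ∀ N ≥ N₀, n < N ∧ p ∈ (b N).loops := by
  obtain ⟨k, hk⟩ := mem_iUnion.mp hp
  exact ⟨max k (n + 1), fun N hN => ⟨by lia, hb.loops_mono hW (by lia : k ≤ N) hk⟩⟩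

theorem limitLoops_allIn (hW : Monotone W) (hb : Consistent b)
    (n : ℕ) : {p ∈ limitLoops b | p.1.2.AllIn (W n)} = (b n).loops := by
  refine subset_antisymm ?_ fun p hp => ⟨mem_iUnion.mpr ⟨n, hp⟩, (b n).allIn p hp⟩
  rintro p ⟨hp, hpn⟩
  obtain ⟨N, hN⟩ := exists_lt_mem_loops hW hb hp n
  obtain ⟨hnN, hpN⟩ := hN N le_rfl
  rw [← hb.loops_eq hW hnN]
  exact ⟨hpN, hpn⟩

theorem limitLoops_unique (hW : Monotone W) (hb : Consistent b)
    {n : ℕ} {s : LegPath d β} {p p' : MarkedLoop d β}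
    (hp : p ∈ limitLoops b) (hp' : p' ∈ limitLoops b) (hs : p.1.2.shreds (W n) {s} ≠ 0)
    (hs' : p'.1.2.shreds (W n) {s} ≠ 0) : p = p' := by
  obtain ⟨N₁, hN₁⟩ := exists_lt_mem_loops hW hb hp n
  obtain ⟨N₂, hN₂⟩ := exists_lt_mem_loops hW hb hp' n
  exact hb.loop_unique hW (hN₁ (max N₁ N₂) (le_max_left _ _)).1
    (hN₁ _ (le_max_left _ _)).2 (hN₂ _ (le_max_right _ _)).2 hs hs'

theorem mem_shreds_of_limitLoops (hW : Monotone W) (hb : Consistent b)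
    {n : ℕ} {s : LegPath d β} {p : MarkedLoop d β}
    (hp : p ∈ limitLoops b) (hs : p.1.2.shreds (W n) {s} ≠ 0) : s ∈ (b n).shreds := by
  obtain ⟨N, hN⟩ := exists_lt_mem_loops hW hb hp n
  by_contra hn
  exact hs (hb.loopShreds_eq_zero hW (hN N le_rfl).1 hn (hN N le_rfl).2)

/-- In a large window, the parent of `s` along the interlacement is a given shred and the loop is a
given loop; both producing `s` would give multiplicity two. -/
theorem not_limitLoops_of_limitInterlacements (hW : Monotone W) (hb : Consistent b)
    (hcpt : ∀ n, IsCompact (W n)) {n : ℕ}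
    {s : LegPath d β} {γ : Interlacement d β}
    (hγ : γ ∈ limitInterlacements b) (hs : γ.shreds (W n) {s} ≠ 0) {p : MarkedLoop d β}
    (hp : p ∈ limitLoops b) : p.1.2.shreds (W n) {s} = 0 := by
  obtain ⟨g, rfl⟩ := Quotient.exists_rep γ
  obtain ⟨a, ha⟩ := Interlacement.shreds_ne_zero_iff.mp hs
  obtain ⟨N, hN⟩ := exists_lt_mem_loops hW hb hp n
  obtain ⟨hnN, hpN⟩ := hN N le_rfl
  have hfit := Trajectory.fits hcpt hγ
  obtain ⟨A, t, ht, -, -, h⟩ := ha.exists_parent hfit.continuous (hW hnN.le) (hfit.exits N)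
  exact hb.not_loop_of_occurs hW hnN (hfit.mem N A t ht) h hpN

/-- A loop starting in the window is either one of its finitely many loops or owns one of its
finitely many shreds, which no other loop shares. -/
theorem finite_limitLoops (hW : Monotone W)
    (hcov : ∀ A : Set (Space d), Bornology.IsBounded A → ∃ n, A ⊆ W n)
    (hb : Consistent b) {A : Set (Space d)} (hA : Bornology.IsBounded A) :
    {p ∈ limitLoops b | p.1.1 ∈ A}.Finite := by
  obtain ⟨m, hm⟩ := hcov A hA
  have hfin : (⋃ s ∈ (b m).shreds, {p ∈ limitLoops b | p.1.2.shreds (W m) {s} ≠ 0}).Finite :=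
    (b m).finite_shreds.biUnion fun s _ => Set.Subsingleton.finite fun p hp p' hp' =>
      limitLoops_unique hW hb hp.1 hp'.1 hp.2 hp'.2
  refine ((b m).finite_loops.union hfin).subset ?_
  rintro p ⟨hp, hpA⟩
  by_cases hin : p.1.2.AllIn (W m)
  · refine .inl ?_
    rw [← limitLoops_allIn hW hb]
    exact ⟨hp, hin⟩
  · obtain ⟨s, hs⟩ := MarkedLoop.exists_one_le_shreds (hm hpA) hin
    have hs' := (zero_lt_one.trans_le hs).ne'
    exact .inr (mem_iUnion₂.mpr ⟨s, mem_shreds_of_limitLoops hW hb hp hs', hp, hs'⟩)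

theorem exists_mem_limitInterlacements (hW : Monotone W)
    (hcov : ∀ A : Set (Space d), Bornology.IsBounded A → ∃ n, A ⊆ W n)
    (hb : Consistent b) {n : ℕ} {s : LegPath d β} (hs : s ∈ (b n).shreds)
    (hp : ∀ p ∈ limitLoops b, p.1.2.shreds (W n) {s} = 0) :
    ∃ γ ∈ limitInterlacements b, γ.shreds (W n) {s} ≠ 0 := by
  obtain ⟨g, hg, hgs⟩ := exists_fits hW hcov hb hs fun N _ p hpN =>
    hp p (mem_iUnion.mpr ⟨N, hpN⟩)
  let g' : Trajectory d β :=
    ⟨⟨g, hg.continuous⟩, fun K hK => hg.finite_particles hW hcov hb hK⟩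
  refine ⟨Quotient.mk _ g', fun m u hu => ?_, Interlacement.shreds_ne_zero_iff.mpr ⟨0, hgs⟩⟩
  obtain ⟨a, ha⟩ := Interlacement.shreds_ne_zero_iff.mp hu
  exact hg.mem m a u ha

theorem limitInterlacements_unique (hW : Monotone W) (hcpt : ∀ n, IsCompact (W n))
    (hcov : ∀ A : Set (Space d), Bornology.IsBounded A → ∃ n, A ⊆ W n)
    (hb : Consistent b) {n : ℕ} {s : LegPath d β} {γ γ' : Interlacement d β}
    (hγ : γ ∈ limitInterlacements b) (hγ' : γ' ∈ limitInterlacements b)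
    (hs : γ.shreds (W n) {s} ≠ 0) (hs' : γ'.shreds (W n) {s} ≠ 0) : γ = γ' := by
  obtain ⟨g, rfl⟩ := Quotient.exists_rep γ
  obtain ⟨g', rfl⟩ := Quotient.exists_rep γ'
  obtain ⟨a, ha⟩ := Interlacement.shreds_ne_zero_iff.mp hs
  obtain ⟨a', ha'⟩ := Interlacement.shreds_ne_zero_iff.mp hs'
  refine Quotient.sound ⟨a - a', fun t => ?_⟩
  have := (Trajectory.fits hcpt hγ).eq_of_occurs hW hcov hb (Trajectory.fits hcpt hγ') ha ha'
    (t - a' * β)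
  rw [sub_add_cancel] at this
  rw [← this]
  congr 1
  push_cast
  ring

theorem finite_limitInterlacements (hW : Monotone W) (hcpt : ∀ n, IsCompact (W n))
    (hcov : ∀ A : Set (Space d), Bornology.IsBounded A → ∃ n, A ⊆ W n)
    (hb : Consistent b) {K : Set (Space d)} (hK : IsCompact K) :
    {γ ∈ limitInterlacements b | γ.Visits K}.Finite := by
  obtain ⟨m, hm⟩ := hcov K hK.isBounded
  have hfin : (⋃ s ∈ (b m).shreds,
      {γ ∈ limitInterlacements b | γ.shreds (W m) {s} ≠ 0}).Finite :=
    (b m).finite_shreds.biUnion fun s _ => Set.Subsingleton.finite fun γ hγ γ' hγ' =>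
      limitInterlacements_unique hW hcpt hcov hb hγ.1 hγ'.1 hγ.2 hγ'.2
  refine hfin.subset ?_
  rintro γ ⟨hγ, hγK⟩
  obtain ⟨g, rfl⟩ := Quotient.exists_rep γ
  obtain ⟨k, hk⟩ : ∃ k : ℤ, g.1 (k * β) ∈ K := hγK
  obtain ⟨a, s, hs, -⟩ := exists_occurs_of_mem g.1.continuous
    (Trajectory.exits (hcpt m) subset_rfl g) (hm hk)
  have hs' := Interlacement.shreds_ne_zero_iff.mpr ⟨a, hs⟩
  exact mem_iUnion₂.mpr ⟨s, hγ m s hs', hγ, hs'⟩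

theorem limitInterlacements_shreds_eq_one (hW : Monotone W) (hcpt : ∀ n, IsCompact (W n))
    (hcov : ∀ A : Set (Space d), Bornology.IsBounded A → ∃ n, A ⊆ W n)
    (hb : Consistent b) {n : ℕ} {s : LegPath d β} {γ : Interlacement d β}
    (hγ : γ ∈ limitInterlacements b) (hs : γ.shreds (W n) {s} ≠ 0) :
    γ.shreds (W n) {s} = 1 := by
  obtain ⟨g, rfl⟩ := Quotient.exists_rep γ
  obtain ⟨a, ha⟩ := Interlacement.shreds_ne_zero_iff.mp hs
  rw [Interlacement.shreds_singleton, tsum_eq_single a, shredAt_of_occurs ha]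
  intro a' ha'
  refine shredAt_of_not_occurs fun h => ha' ?_
  exact (Trajectory.fits hcpt hγ).occurs_unique hW hcov hb h ha

/-- A given shred produced by a loop is produced once and by nothing else. If no loop produces it,
gluing provides an interlacement, which is unique and contains the shred once. -/
theorem limit_mult (hW : Monotone W) (hcpt : ∀ n, IsCompact (W n))
    (hcov : ∀ A : Set (Space d), Bornology.IsBounded A → ∃ n, A ⊆ W n)
    (hb : Consistent b) (n : ℕ) (s : LegPath d β) :
    ∑' p : limitLoops b, p.1.1.2.shreds (W n) {s} +
      ∑' γ : limitInterlacements b, γ.1.shreds (W n) {s} = (b n).shreds.indicator 1 s := by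
  by_cases hs : s ∈ (b n).shreds
  · rw [indicator_of_mem hs, Pi.one_apply]
    by_cases hp : ∃ p ∈ limitLoops b, p.1.2.shreds (W n) {s} ≠ 0
    · obtain ⟨p, hp, hps⟩ := hp
      rw [tsum_eq_single (⟨p, hp⟩ : limitLoops b), ENNReal.tsum_eq_zero.mpr, add_zero]
      · obtain ⟨N, hN⟩ := exists_lt_mem_loops hW hb hp n
        exact hb.loopShreds_eq_one hW (hN N le_rfl).1 (hN N le_rfl).2 hps
      · intro γ
        by_contra h
        exact hps (not_limitLoops_of_limitInterlacements hW hb hcpt γ.2 h hp)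
      · rintro ⟨p', hp'⟩ hne
        by_contra h
        exact hne (Subtype.ext (limitLoops_unique hW hb hp' hp h hps))
    · push Not at hp
      obtain ⟨γ, hγ, hγs⟩ := exists_mem_limitInterlacements hW hcov hb hs hp
      rw [ENNReal.tsum_eq_zero.mpr fun p : limitLoops b => hp p p.2, zero_add,
        tsum_eq_single (⟨γ, hγ⟩ : limitInterlacements b)]
      · exact limitInterlacements_shreds_eq_one hW hcpt hcov hb hγ hγs
      · rintro ⟨γ', hγ'⟩ hne
        by_contra h
        exact hne (Subtype.ext (limitInterlacements_unique hW hcpt hcov hb hγ' hγ h hγs))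
  · rw [indicator_of_notMem hs, add_eq_zero, ENNReal.tsum_eq_zero, ENNReal.tsum_eq_zero]
    constructor
    · intro p
      by_contra h
      exact hs (mem_shreds_of_limitLoops hW hb p.2 h)
    · intro γ
      by_contra h
      exact hs (γ.2 n s h)

theorem exists_config_proj_eq (hW : Monotone W) (hcpt : ∀ n, IsCompact (W n))
    (hcov : ∀ A : Set (Space d), Bornology.IsBounded A → ∃ n, A ⊆ W n)
    (hb : Consistent b) : ∃ c : Config d β, ∀ n, c.proj (W n) = (b n).toMeasures := by
  refine ⟨⟨limitLoops b, limitInterlacements b, fun A hA => finite_limitLoops hW hcov hb hA,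
    fun K hK => finite_limitInterlacements hW hcpt hcov hb hK⟩, fun n => Prod.ext ?_ ?_⟩
  · exact congrArg pointMeasure (limitLoops_allIn hW hb n)
  · refine IsDiscrete.ext (.add (.sum fun p => Loop.isDiscrete_shreds _)
      (.sum fun γ => Interlacement.isDiscrete_shreds _)) (isDiscrete_pointMeasure _) fun s => ?_
    simp only [Config.proj, BoxConfig.toMeasures]
    rw [pointMeasure_singleton, Measure.add_apply, Measure.sum_apply _ (measurableSet_singleton s),
      Measure.sum_apply _ (measurableSet_singleton s)]
    exact limit_mult hW hcpt hcov hb n s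

end Limit

/-! ### The boxes -/

section Box

variable {d : ℕ}

theorem box_mono {R S : ℕ+} (h : R ≤ S) : box d R ⊆ box d S := fun _ hx i =>
  (hx i).trans (Nat.cast_le.mpr h)

theorem isCompact_box (R : ℕ+) : IsCompact (box d R) := by
  refine Metric.isCompact_of_isClosed_isBounded ?_ ?_
  · unfold box
    simp only [ofPred_forall]
    exact isClosed_iInter fun i => isClosed_le (by fun_prop) continuous_const
  · have h : Bornology.IsBounded (Icc (fun _ => -(R : ℝ)) fun _ => (R : ℝ) : Set (Fin d → ℝ)) :=
      Metric.isBounded_Icc _ _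
    have h2 := (PiLp.antilipschitzWith_ofLp 2 fun _ : Fin d => ℝ).isBounded_preimage h
    refine h2.subset fun x hx => ⟨fun i => (abs_le.mp (hx i)).1, fun i => (abs_le.mp (hx i)).2⟩

theorem exists_subset_box {A : Set (Space d)} (hA : Bornology.IsBounded A) :
    ∃ n : ℕ, A ⊆ box d n.succPNat := by
  obtain ⟨r, hr⟩ := hA.exists_norm_le
  obtain ⟨n, hn⟩ := exists_nat_ge r
  refine ⟨n, fun x hx i => ?_⟩
  calc |x i| = ‖x i‖ := (Real.norm_eq_abs _).symm
    _ ≤ ‖x‖ := PiLp.norm_apply_le x i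
    _ ≤ (n.succPNat : ℝ) := by
      rw [Nat.succPNat_coe]
      push_cast
      linarith [hr x hx]

end Box

end BoseGas

end

/-! ### The extension theorem for the boxes -/

theorem proposition4p1 (d : ℕ) (β : ℝ) [Fact (0 < β)]
    (ξ : ∀ R : ℕ+, MeasureTheory.Measure (BoseGas.BoxConfig β (BoseGas.box d R)))
    (hprob : ∀ R, MeasureTheory.IsProbabilityMeasure (ξ R))
    (hcons : ∀ R : ℕ+, (ξ (R + 1)).map (BoseGas.BoxConfig.proj (BoseGas.box d R)) =
      (ξ R).map BoseGas.BoxConfig.toMeasures) :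
    ∃! P : MeasureTheory.Measure (BoseGas.Config d β),
      MeasureTheory.IsProbabilityMeasure P ∧
        ∀ R : ℕ+, P.map (BoseGas.Config.proj (BoseGas.box d R)) =
          (ξ R).map BoseGas.BoxConfig.toMeasures := by
  -- The boxes are indexed from zero by `n.succPNat`, so `W 0` is the box with `R = 1`; the
  -- bijection of `ℕ+` with `ℕ` translates back at the end.
  let W : ℕ → Set (BoseGas.Space d) := fun n => BoseGas.box d n.succPNat
  have hW : Monotone W := fun m n h =>
    BoseGas.box_mono (PNat.coe_le_coe _ _ |>.mp (by simpa using h))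
  have hcpt : ∀ n, IsCompact (W n) := fun n => BoseGas.isCompact_box _
  have hcov : ∀ A : Set (BoseGas.Space d), Bornology.IsBounded A → ∃ n, A ⊆ W n :=
    fun A hA => BoseGas.exists_subset_box hA
  have : ∀ n, MeasureTheory.IsProbabilityMeasure (ξ (Nat.succPNat n)) := fun n => hprob _
  have hall : ∀ {p : ℕ+ → Prop}, (∀ n : ℕ, p (Nat.succPNat n)) ↔ ∀ R, p R := fun {p} =>
    Equiv.pnatEquivNat.symm.forall_congr_right (q := p)
  have : ∀ n, StandardBorelSpace (BoseGas.BoxConfig β (W n)) := fun n =>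
    BoseGas.BoxConfig.standardBorelSpace (BoseGas.measurableSet_box _)
  have key := existsUnique_measure_of_consistent (C := BoseGas.Config d β)
    (B := fun n => BoseGas.BoxConfig β (W n))
    (T := fun n => BoseGas.BoxConfig.toMeasures)
    (fun n => BoseGas.BoxConfig.measurableEmbedding_toMeasures (BoseGas.measurableSet_box _))
    (fun n => BoseGas.BoxConfig.proj (W n)) (fun n => ξ (Nat.succPNat n))
    (fun n => hcons (Nat.succPNat n)) (fun n => BoseGas.Config.proj (W n))
    (Equiv.pnatEquivNat.symm.iSup_comp (g := fun R : ℕ+ =>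
      MeasurableSpace.comap (BoseGas.Config.proj (BoseGas.box d R)) inferInstance)).symm
    (fun b hb => BoseGas.exists_config_proj_eq hW hcpt hcov hb)
    (fun c n b h => BoseGas.Config.proj_eq_proj (hW n.le_succ) (hcpt (n + 1)) subset_rfl c b h)
  refine (existsUnique_congr fun P => and_congr_right fun _ => ?_).mp key
  exact hall (p := fun R => P.map (BoseGas.Config.proj (BoseGas.box d R)) =
    (ξ R).map BoseGas.BoxConfig.toMeasures)
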